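/- Let $n\ge 2$, let $K$ be a commutative ring and $M$ a $K$-module, and work in the exterior algebra $\bigwedge_K M$. Let $B=(b_{ij})$ be a symmetric $n\times n$ matrix over $K$ and let $(\omega_{ij})$ be a symmetric $n\times n$ matrix of elements of $M$ ("one-forms", $\omega_{ij}=\omega_{ji}$). (The generic case is $K=\mathbb{Q}[b_{ij}]$ with $b_{ij}=b_{ji}$, and $M$ the free $K$-module on the $\omega_{ij}$, $i\le j$.) A *type of rank $n$* is a set $\nu\subset\{1,\dots,n\}^2$ with $2n-1$ elements; it is *upper-triangular* if $\mathrm{diag}_n=\{(1,1),\dots,(n,n)\}\subset\nu$ and $i\le j$ for all $(i,j)\in\nu$. Let $\Upsilon_\nu$ be the symmetric matrix whose $(i,j)$ entry is $\omega_{ij}$ if $(i,j)\in\nu$ or $(j,i)\in\nu$, and $0$ otherwise. *The form $\omega_\nu$.* Choose an ordering $\nu=((i_1,j_1),\dots,(i_{2n-1},j_{2n-1}))$ and $1\le k\le 2n$. Let $M_\nu$ be the $(2n-1)\times 2n$ integer matrix whose $r$-th row has $-1$ in column $i_r$, $1$ in column $n+j_r$ and $0$ elsewhere, and let $M_\nu^{\emptyset,k}$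 be $M_\nu$ with its $k$-th column deleted. Put $$\omega_\nu=(-1)^{\binom n2+k-1}\det(M_\nu^{\emptyset,k})\;\omega_{i_1j_1}\wedge\dots\wedge\omega_{i_{2n-1}j_{2n-1}}.$$ *The polynomial $\Sigma$.* Let $m\ge 2$ be even and let $\mathcal{E}=(\mathcal{E}_1,\dots,\mathcal{E}_m)$, $\mathcal{E}_r=(s_r,t_r)$, be an ordered set of pairs. For $I=\{r_1<\dots<r_c\}\subset\{1,\dots,m\}$ put $\mathcal{E}_I=(s_{r_1},t_{r_1},\dots,s_{r_c},t_{r_c})$, and let $B_{\mathcal{E}_I,\mathcal{E}_J}$ be the matrix of entries of $B$ with rows indexed by $\mathcal{E}_I$ and columns indexed by $\mathcal{E}_J$, in order and with repetitions. Let $\mathcal{D}^k_m$ be the set of unordered $k$-tuples $\{\{I_1,J_1\},\dots,\{I_k,J_k\}\}$ such that $\{1,\dots,m\}$ is the disjoint union of $I_1,\dots,I_k,J_1,\dots,J_k$, and $I_r$, $J_r$ are non-empty with $|I_r|=|J_r|$ for all $r$. Put $$\Sigma(B,\mathcal{E})=\sum_{k=1}^{m/2}(-2)^k\,k!\sum_{\{\{I_1,J_1\},\dots,\{I_k,J_k\}\}\in\mathcal{D}^k_m}\det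 B_{\mathcal{E}_{I_1},\mathcal{E}_{J_1}}\cdots\det B_{\mathcal{E}_{I_k},\mathcal{E}_{J_k}}.$$ **Theorem.** Let $\nu$ be an upper-triangular type of rank $n$. If $n$ is odd then, for every choice of the ordering of $\nu$ and of the column $k$ in the definition of $\omega_\nu$, and for every ordering of $\mathcal{E}=\nu\setminus\mathrm{diag}_n$, $$\mathrm{tr}\left((B\Upsilon_\nu)^{2n-1}\right)=(2n-1)\,\det(B)\,\Sigma(B,\nu\setminus\mathrm{diag}_n)\,\omega_\nu .$$ If $n$ is even then $\mathrm{tr}\left((B\Upsilon_\nu)^{2n-1}\right)=0$. -/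

import Mathlib

namespace InvariantForm

/-- The diagonal pairs `(1,1), …, (n,n)`. -/
def diag (n : ℕ) : Finset (Fin n × Fin n) :=
  Finset.univ.image fun i => (i, i)

/-- A type of rank `n`: a set of pairs of indices of cardinality `2n - 1`. -/
def IsType {n : ℕ} (ν : Finset (Fin n × Fin n)) : Prop :=
  ν.card = 2 * n - 1

/-- A type is upper-triangular if it contains the diagonal and all of its elements
`(i, j)` satisfy `i ≤ j`. -/
def IsUpperTriangular {n : ℕ} (ν : Finset (Fin n × Fin n)) : Prop :=
  IsType ν ∧ diag n ⊆ ν ∧ ∀ p ∈ ν, p.1 ≤ p.2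

section Forms

variable {K : Type*} [CommRing K] {M : Type*} [AddCommGroup M] [Module K M] {n : ℕ}

/-- The symmetric matrix of one-forms `Υ_ν`, obtained from the symmetric matrix of one-forms
`υ = (ω_ij)` by setting `ω_ij = ω_ji` to zero unless `(i, j)` or `(j, i)` lies in `ν`. The
entries are in the exterior algebra. -/
def upsilon (K : Type*) [CommRing K] [Module K M] (υ : Matrix (Fin n) (Fin n) M)
    (ν : Finset (Fin n × Fin n)) : Matrix (Fin n) (Fin n) (ExteriorAlgebra K M) :=
  Matrix.of fun i j =>
    if (i, j) ∈ ν ∨ (j, i) ∈ ν then ExteriorAlgebra.ι K (υ i j) else 0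

/-- The trace of `(B Υ_ν) ^ (2n - 1)`, a form in the exterior algebra. -/
def tracePow (B : Matrix (Fin n) (Fin n) K) (υ : Matrix (Fin n) (Fin n) M)
    (ν : Finset (Fin n × Fin n)) : ExteriorAlgebra K M :=
  (((B.map (algebraMap K (ExteriorAlgebra K M))) * upsilon K υ ν) ^ (2 * n - 1)).trace

/-- The matrix `M_ν` of size `(2n - 1) × 2n` attached to an ordering `e` of the type `ν`: the row
of `(i, j)` has `-1` in column `i`, `1` in column `n + j` and `0` elsewhere. -/
def incidence {ν : Finset (Fin n × Fin n)} (e : Fin (2 * n - 1) ≃ ν) :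
    Matrix (Fin (2 * n - 1)) (Fin (2 * n)) ℤ :=
  Matrix.of fun a c =>
    if (c : ℕ) = ((e a).1.1 : ℕ) then -1
    else if (c : ℕ) = n + ((e a).1.2 : ℕ) then 1
    else 0

/-- The square matrix obtained by deleting column `k` from `M_ν`. -/
def incidenceMinor {ν : Finset (Fin n × Fin n)} (e : Fin (2 * n - 1) ≃ ν) (k : Fin (2 * n)) :
    Matrix (Fin (2 * n - 1)) (Fin (2 * n - 1)) ℤ :=
  (incidence e).submatrix id fun b =>
    ⟨if (b : ℕ) < (k : ℕ) then (b : ℕ) else (b : ℕ) + 1, by split_ifs <;> omega⟩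

/-- The form `η_ν`: the product of the `ω_ij`, for `(i, j)` in `ν`, in the order given by `e`. -/
def eta (K : Type*) [CommRing K] [Module K M] (υ : Matrix (Fin n) (Fin n) M)
    {ν : Finset (Fin n × Fin n)} (e : Fin (2 * n - 1) ≃ ν) : ExteriorAlgebra K M :=
  (List.ofFn fun a => ExteriorAlgebra.ι K (υ (e a).1.1 (e a).1.2)).prod

/-- The form `ω_ν`, computed with the ordering `e` of `ν` and the deleted column `k`. Columns are
numbered from `0`, so the sign `(-1) ^ (binom n 2 + k - 1)` for columns numbered from `1` becomes
`(-1) ^ (binom n 2 + k)`. -/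
def omega (K : Type*) [CommRing K] [Module K M] (υ : Matrix (Fin n) (Fin n) M)
    {ν : Finset (Fin n × Fin n)} (e : Fin (2 * n - 1) ≃ ν) (k : Fin (2 * n)) :
    ExteriorAlgebra K M :=
  ((-1 : ℤ) ^ (n.choose 2 + (k : ℕ)) * (incidenceMinor e k).det) • eta K υ e

end Forms

section Sigma

/-- A set `T` of unordered pairs `{I, J}` of subsets of `{1, …, m}` such that `{1, …, m}` is the
disjoint union of all the `I`, `J` occurring in `T`, all of these are non-empty, and
`|I| = |J|` for every pair `{I, J}` in `T`. -/
def IsPairing {m : ℕ} (T : Finset (Sym2 (Finset (Fin m)))) : Prop :=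
  (∀ I J : Finset (Fin m), s(I, J) ∈ T →
    I.Nonempty ∧ J.Nonempty ∧ Disjoint I J ∧ I.card = J.card) ∧
  (∀ z ∈ T, ∀ w ∈ T, z ≠ w → ∀ I J : Finset (Fin m), I ∈ z → J ∈ w → Disjoint I J) ∧
  (∀ x : Fin m, ∃ z ∈ T, ∃ I : Finset (Fin m), I ∈ z ∧ x ∈ I)

instance {m : ℕ} : DecidablePred (IsPairing (m := m)) := fun _ =>
  @instDecidableAnd _ _ inferInstance (@instDecidableAnd _ _ inferInstance inferInstance)

/-- The set `D^k_m` of unordered `k`-tuples `{{I₁, J₁}, …, {I_k, J_k}}` such that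
`{1, …, m}` is the disjoint union of `I₁, …, I_k, J₁, …, J_k`, all of which are
non-empty, and `|I_i| = |J_i|` for all `i`. -/
def pairings (m k : ℕ) : Finset (Finset (Sym2 (Finset (Fin m)))) :=
  (Finset.powersetCard k Finset.univ).filter IsPairing

variable {K : Type*} [CommRing K] {n m : ℕ}

/-- The entries of the tuple `E_I = (s_{i₁}, t_{i₁}, …, s_{i_c}, t_{i_c})` where
`I = {i₁ < … < i_c}` and `E_i = (s_i, t_i)`. Positions are labelled by `(a, 0)`
for `s_{i_a}` and by `(a, 1)` for `t_{i_a}`. -/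
def tuple (E : Fin m → Fin n × Fin n) (I : Finset (Fin m)) {c : ℕ} (h : I.card = c) :
    Fin c × Fin 2 → Fin n :=
  fun a => if a.2 = 0 then (E (I.orderEmbOfFin h a.1)).1 else (E (I.orderEmbOfFin h a.1)).2

/-- The determinant of `B_{E_I, E_J}`, for `|I| = |J|` (and `0` by convention otherwise). -/
def detBlock (B : Matrix (Fin n) (Fin n) K) (E : Fin m → Fin n × Fin n)
    (I J : Finset (Fin m)) : K :=
  if h : I.card = J.card then (B.submatrix (tuple E I h) (tuple E J rfl)).det else 0

theorem detBlock_comm {B : Matrix (Fin n) (Fin n) K} (hB : B.IsSymm)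
    (E : Fin m → Fin n × Fin n) (I J : Finset (Fin m)) :
    detBlock B E I J = detBlock B E J I := by
  have key : ∀ (c d : ℕ) (hcd : c = d) (hI : I.card = c) (hJ : J.card = c)
      (hI' : I.card = d) (hJ' : J.card = d),
      (B.submatrix (tuple E I hI) (tuple E J hJ)).det =
        (B.submatrix (tuple E J hJ') (tuple E I hI')).det := by
    intro c d hcd hI hJ hI' hJ'
    subst hcd
    rw [← Matrix.det_transpose, Matrix.transpose_submatrix, hB.eq]
  unfold detBlock
  by_cases h : I.card = J.card
  · rw [dif_pos h, dif_pos h.symm]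
    exact key _ _ h.symm _ _ _ _
  · rw [dif_neg h, dif_neg (Ne.symm h)]

/-- The determinant `det B_{E_I, E_J}` as a function of the unordered pair `{I, J}`. It is
well defined because `B` is symmetric. -/
def pairDet {B : Matrix (Fin n) (Fin n) K} (hB : B.IsSymm) (E : Fin m → Fin n × Fin n) :
    Sym2 (Finset (Fin m)) → K :=
  Sym2.lift ⟨detBlock B E, detBlock_comm hB E⟩

/-- The polynomial `Σ(B, E)` for an ordered `m`-tuple of pairs `E`. -/
def Sigma {B : Matrix (Fin n) (Fin n) K} (hB : B.IsSymm) (E : Fin m → Fin n × Fin n) : K :=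
  ∑ k ∈ Finset.Icc 1 (m / 2), (-2 : K) ^ k * (k.factorial : K) *
    ∑ T ∈ pairings m k, ∏ z ∈ T, pairDet hB E z

end Sigma

end InvariantForm

/-! Put `Y = BΥ`, a matrix of one-forms. The entries of `Y²` lie in the commutative centre of the
exterior algebra. Moving a one-form cyclically past an odd product changes the sign, so every
positive power of `Y²` has trace zero. Over a `ℚ`-algebra this forces characteristic polynomial
`X^n` and `(Y²)^(n-1) = (-1)^(n-1) adj(Y²)`. Since `Y² = BW` with `W = ΥBΥ`, the product of
`tr(Y^(2n-1))` with an auxiliary one-form `ξ` is, up to sign, `det B` times the sum over `l` of `det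
W` with column `l` replaced by the products `Υ_al ξ` (`trace_pow_mul_ι`).

By multilinearity each off-diagonal pair of `ν` can be given one of two orientations; let `A` be the
set of reversed pairs. For a fixed orientation, `ν` is the edge set of a bipartite graph with
incidence matrix `M_ν`. Expanding the determinants, the signs from reordering one-forms turn
determinants into permanents. Each surviving term uses every edge and `ξ` exactly once, so all its
permanents agree; what remains is a product of vertex forms, that is, a maximal minor of `M_ν`
(`altTrace_single`). Reversing a pair changes the sign of that minor. Hence, for `n` of either
parity, the trace is `(2n-1) det B · P · ω_ν` with `P = ∑_A (-1)^|A| perm B_A`, where `B_A` is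
`flipMatrix` (`tracePow_eq`).

For even `n` the number `n-1` of pairs is odd, and replacing `A` by its complement transposes `B_A`
and changes the sign, so `P = 0`. For odd `n` it remains to see that `P = Σ`. Both extend to
functions of a set `U` of positions, and both are inverse, under subset convolution, to `D(V) = ∑_{I
⊆ V} det B_{I, V∖I}`. For `Σ` this is the removal of one pair. For `P` it follows from Muir's
identity and `D(V) = (-1)^|V| ∑_A (-1)^|A| det (B_A)_V` (`sum_detBlock`), a consequence of an
identity for square-zero elements.

Steps needing `ℚ` or `√-1` are done for generic matrices and specialized, the identities being
polynomial with integer coefficients. -/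

/-! ### Matrices all of whose powers have trace zero -/

open Polynomial in
/-- The derivative of a determinant of polynomials. -/
theorem Matrix.derivative_det_eq_trace_adjugate_mul {R ι : Type*} [CommRing R] [Fintype ι] [DecidableEq ι]
    (A : Matrix ι ι R[X]) :
    derivative A.det = (A.adjugate * A.map derivative).trace := by
  have h1 : (A.adjugate * A.map derivative).trace
      = ∑ i, (A.updateCol i (fun a => derivative (A a i))).det := by
    simp only [Matrix.trace, Matrix.diag]
    refine Finset.sum_congr rfl fun i _ => ?_
    rw [← Matrix.cramer_apply, Matrix.cramer_eq_adjugate_mulVec]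
    simp [Matrix.mul_apply, Matrix.mulVec, dotProduct]
  rw [h1, Matrix.det_apply']
  simp only [Matrix.det_apply', derivative_sum]
  rw [Finset.sum_comm]
  refine Finset.sum_congr rfl fun σ _ => ?_
  rw [derivative_mul, derivative_intCast, zero_mul, zero_add, Polynomial.derivative_prod_finset,
    Finset.mul_sum]
  refine Finset.sum_congr rfl fun i _ => ?_
  rw [← Finset.mul_prod_erase Finset.univ _ (Finset.mem_univ i)]
  have : ∏ x ∈ Finset.univ.erase i, (A.updateCol i fun a => derivative (A a i)) (σ x) x
      = ∏ x ∈ Finset.univ.erase i, A (σ x) x :=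
    Finset.prod_congr rfl fun x hx => by simp [Finset.ne_of_mem_erase hx]
  rw [this]
  simp only [Matrix.updateCol_self]
  congr 1
  exact mul_comm _ _

-- With `A = 1 - XZ`, the trace of `adj(A) A Z^k` gives `tr(adj(A) Z^k) = X tr(adj(A) Z^(k+1))` for
-- `k ≥ 1`. So `tr(adj(A) Z)` is divisible by every power of `X` and vanishes. Up to sign it is the
-- derivative of `det A`, which is therefore constant.
open Polynomial in
theorem Matrix.charpolyRev_eq_one_of_trace_pow_eq_zero {R ι : Type*} [CommRing R] [Algebra ℚ R]
    [Fintype ι] [DecidableEq ι] (Z : Matrix ι ι R) (hZ : ∀ k, 1 ≤ k → (Z ^ k).trace = 0) :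
    Z.charpolyRev = 1 := by
  set A : Matrix ι ι R[X] := 1 - (X : R[X]) • Z.map C with hA
  set q : ℕ → R[X] := fun k => (A.adjugate * (Z.map C) ^ k).trace with hq
  have hstep : ∀ k, 1 ≤ k → q k = X * q (k + 1) := by
    intro k hk
    have h1 : A.adjugate * A * (Z.map C) ^ k = A.det • (Z.map C) ^ k := by
      rw [Matrix.adjugate_mul, Matrix.smul_mul, one_mul]
    have h2 : A.adjugate * A * (Z.map C) ^ k
        = A.adjugate * (Z.map C) ^ k - (X : R[X]) • (A.adjugate * (Z.map C) ^ (k + 1)) := by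
      rw [hA, mul_sub, sub_mul, mul_one, ← hA, pow_succ']
      simp [mul_assoc]
    have h3 : ((Z.map C) ^ k).trace = 0 := by
      have : (Z.map (C : R →+* R[X])) ^ k = (Z ^ k).map C := by
        have := map_pow (RingHom.mapMatrix (m := ι) (C : R →+* R[X])) Z k
        simpa [RingHom.mapMatrix_apply] using this.symm
      rw [this]
      have h4 := AddMonoidHom.map_trace (C : R →+* R[X]) (Z ^ k)
      rw [← h4, hZ k hk]; simp
    have h4 := congrArg Matrix.trace (h2.symm.trans h1)
    rw [Matrix.trace_sub, Matrix.trace_smul, Matrix.trace_smul, h3, smul_zero, sub_eq_zero] at h4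
    simpa [hq] using h4
  have hdvd : ∀ j, X ^ j ∣ q 1 := by
    have : ∀ j, q 1 = X ^ j * q (1 + j) := by
      intro j
      induction j with
      | zero => simp
      | succ j ih => rw [ih, hstep (1 + j) (by omega), pow_succ, mul_assoc, add_assoc]
    exact fun j => ⟨_, this j⟩
  have hq1 : q 1 = 0 := by
    ext d
    exact (X_pow_dvd_iff.1 (hdvd (d + 1))) d (Nat.lt_succ_self d)
  have hder : derivative Z.charpolyRev = 0 := by
    rw [Matrix.charpolyRev, Matrix.derivative_det_eq_trace_adjugate_mul]
    have : A.map derivative = - Z.map C := by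
      ext a b : 2
      simp [hA, Matrix.one_apply, apply_ite derivative]
    rw [← hA, this, mul_neg, Matrix.trace_neg]
    have := hq1
    simp only [hq, pow_one] at this
    rw [this, neg_zero]
  have : IsAddTorsionFree R := IsAddTorsionFree.of_module_rat R
  have h0 := Polynomial.derivative_eq_zero.1 hder
  rw [Polynomial.eq_C_of_natDegree_eq_zero h0, Polynomial.coeff_zero_eq_eval_zero,
    Matrix.eval_charpolyRev, map_one]

open Polynomial in
theorem Matrix.charpoly_eq_X_pow_of_trace_pow_eq_zero {R ι : Type*} [CommRing R] [Algebra ℚ R]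
    [Fintype ι] [DecidableEq ι] (Z : Matrix ι ι R) (hZ : ∀ k, 1 ≤ k → (Z ^ k).trace = 0) :
    Z.charpoly = X ^ Fintype.card ι := by
  nontriviality R
  have h := Matrix.charpolyRev_eq_one_of_trace_pow_eq_zero Z hZ
  rw [← Matrix.reverse_charpoly, Polynomial.reverse] at h
  have h2 := congrArg (Polynomial.reflect Z.charpoly.natDegree) h
  rw [Polynomial.reflect_reflect, Matrix.charpoly_natDegree_eq_dim] at h2
  rw [h2]
  exact Polynomial.reflect_one _

-- Here `Z^n = 0`, so the geometric sum `G = ∑ X^i Z^(n-1-i)` satisfies `(X - Z) G = X^n`. The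
-- determinant of `X - Z` is also `X^n`, a regular element, so `adj(X - Z) = G`; evaluate at `X =
-- 0`.
open Polynomial in
theorem Matrix.adjugate_eq_of_trace_pow_eq_zero {R ι : Type*} [CommRing R] [Algebra ℚ R]
    [Fintype ι] [DecidableEq ι] [Nonempty ι] (Z : Matrix ι ι R)
    (hZ : ∀ k, 1 ≤ k → (Z ^ k).trace = 0) :
    Z ^ (Fintype.card ι - 1) = (-1 : R) ^ (Fintype.card ι - 1) • Z.adjugate := by
  set n := Fintype.card ι with hn
  have hch := Matrix.charpoly_eq_X_pow_of_trace_pow_eq_zero Z hZ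
  have hZn : Z ^ n = 0 := by
    have := Matrix.aeval_self_charpoly Z
    rwa [hch, map_pow, aeval_X] at this
  set ZC : Matrix ι ι R[X] := Z.map C with hZC
  have hZCn : ZC ^ n = 0 := by
    have := map_pow (RingHom.mapMatrix (m := ι) (C : R →+* R[X])) Z n
    rw [hZn, map_zero] at this
    exact this.symm
  set XI : Matrix ι ι R[X] := Matrix.scalar ι X with hXI
  have hcomm : Commute XI ZC := Matrix.scalar_commute _ (fun r => Commute.all _ r) _
  have hgeom := hcomm.mul_geom_sum₂ n
  rw [hZCn, sub_zero] at hgeom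
  have hcm : Z.charmatrix = XI - ZC := rfl
  set G := ∑ i ∈ Finset.range n, XI ^ i * ZC ^ (n - 1 - i) with hG
  have hXn : XI ^ n = (X ^ n : R[X]) • (1 : Matrix ι ι R[X]) := by
    rw [hXI, ← map_pow, Matrix.smul_one_eq_diagonal]; rfl
  have hadj : Z.charmatrix.adjugate * Z.charmatrix = (X ^ n : R[X]) • 1 := by
    rw [Matrix.adjugate_mul, ← hch]; rfl
  have key : (X ^ n : R[X]) • Z.charmatrix.adjugate = (X ^ n : R[X]) • G := by
    have h1 : Z.charmatrix.adjugate * (Z.charmatrix * G) = (X ^ n : R[X]) • G := by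
      rw [← mul_assoc, hadj, Matrix.smul_mul, one_mul]
    rw [hcm, hgeom, hXn, Matrix.mul_smul, mul_one, ← hcm] at h1
    exact h1
  have key2 : Z.charmatrix.adjugate = G := by
    refine Matrix.ext fun a b => ?_
    have := congrFun (congrFun key a) b
    simp only [Matrix.smul_apply, smul_eq_mul] at this
    exact (Polynomial.Monic.isRegular (monic_X_pow n)).left this
  have key3 := congrArg (RingHom.mapMatrix (m := ι) (evalRingHom (0 : R))) key2
  rw [RingHom.map_adjugate] at key3
  have e1 : (evalRingHom (0 : R)).mapMatrix Z.charmatrix = - Z := by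
    ext a b
    rcases eq_or_ne a b with h | h <;> simp [h]
  have e2 : (evalRingHom (0 : R)).mapMatrix XI = 0 := by
    ext a b
    rcases eq_or_ne a b with h | h <;> simp [hXI, Matrix.scalar_apply, h]
  have e3 : (evalRingHom (0 : R)).mapMatrix ZC = Z := by
    ext a b; simp [hZC]
  have hnpos : 0 < n := Fintype.card_pos
  rw [e1, hG, map_sum, Finset.sum_eq_single 0] at key3
  · rw [map_mul, map_pow, map_pow, e2, e3, pow_zero, one_mul, Nat.sub_zero] at key3
    rw [← key3, show -Z = (-1 : R) • Z by simp, Matrix.adjugate_smul]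
  · intro i _ hi
    rw [map_mul, map_pow, e2, zero_pow hi, zero_mul]
  · simp [hnpos.ne']

/-! ### Central two-forms and the top-degree coefficient -/

namespace InvariantForm

open ExteriorAlgebra

section Central

variable {K : Type*} [CommRing K] {V : Type*} [AddCommGroup V] [Module K V]

theorem ι_mul_ι_comm (a b : V) : ι K a * ι K b = -(ι K b * ι K a) :=
  eq_neg_of_add_eq_zero_left (ι_add_mul_swap a b)

theorem ι_mul_ι_mem_center (a b : V) :
    ι K a * ι K b ∈ Subalgebra.center K (ExteriorAlgebra K V) := by
  rw [Subalgebra.mem_center_iff]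
  intro x
  induction x using ExteriorAlgebra.induction with
  | algebraMap r => exact Algebra.commutes r _
  | ι c =>
    rw [← mul_assoc, ι_mul_ι_comm c a, neg_mul, mul_assoc, ι_mul_ι_comm c b, mul_neg, neg_neg,
      mul_assoc]
  | mul x y hx hy => rw [mul_assoc, hy, ← mul_assoc, hx, mul_assoc]
  | add x y hx hy => rw [add_mul, mul_add, hx, hy]

/-- The product of two one-forms, as an element of the centre of the exterior algebra. -/
def wedge (K : Type*) [CommRing K] {V : Type*} [AddCommGroup V] [Module K V] :
    V →ₗ[K] V →ₗ[K] Subalgebra.center K (ExteriorAlgebra K V) :=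
  LinearMap.mk₂ K (fun a b => ⟨ι K a * ι K b, ι_mul_ι_mem_center a b⟩)
    (fun a a' b => Subtype.ext (by simp [add_mul]))
    (fun r a b => Subtype.ext (by simp))
    (fun a b b' => Subtype.ext (by simp [mul_add]))
    (fun r a b => Subtype.ext (by simp))

@[simp]
theorem coe_wedge (a b : V) : (wedge K a b : ExteriorAlgebra K V) = ι K a * ι K b := rfl

theorem wedge_comm (a b : V) : wedge K a b = -wedge K b a :=
  Subtype.ext (by simpa using ι_mul_ι_comm a b)

theorem wedge_mul_wedge_eq_zero (a b c : V) : wedge K a b * wedge K a c = 0 := by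
  refine Subtype.ext ?_
  change ι K a * ι K b * (ι K a * ι K c) = 0
  rw [ι_mul_ι_comm a b, neg_mul, mul_assoc, ← mul_assoc (ι K a), ι_sq_zero]
  simp

theorem ι_mul_ιMulti (b : V) {d : ℕ} (a : Fin d → V) :
    ι K b * ιMulti K d a = (-1 : ℤ) ^ d • (ιMulti K d a * ι K b) := by
  induction d with
  | zero => simp
  | succ d ih =>
    rw [ιMulti_succ_apply, ← mul_assoc, ι_mul_ι_comm, neg_mul, mul_assoc, ih, pow_succ,
      mul_smul_comm, mul_smul, neg_one_smul, smul_neg, mul_assoc]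

/-- A product of products of pairs of one-forms, with the first factors moved to the front. -/
theorem prod_wedge {d : ℕ} (a b : Fin d → V) :
    ((∏ c, wedge K (a c) (b c) : Subalgebra.center K (ExteriorAlgebra K V)) :
      ExteriorAlgebra K V) = (-1 : ℤ) ^ d.choose 2 • (ιMulti K d a * ιMulti K d b) := by
  induction d with
  | zero => simp
  | succ d ih =>
    rw [Fin.prod_univ_succ, MulMemClass.coe_mul, ih (fun c => a c.succ) (fun c => b c.succ),
      ιMulti_succ_apply, ιMulti_succ_apply, coe_wedge]
    change _ = _ • (ι K (a 0) * ιMulti K d (fun c => a c.succ) *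
      (ι K (b 0) * ιMulti K d (fun c => b c.succ)))
    have h : ιMulti K d (fun c => a c.succ) * ι K (b 0)
        = (-1 : ℤ) ^ d • (ι K (b 0) * ιMulti K d (fun c => a c.succ)) := by
      rw [ι_mul_ιMulti, smul_smul, ← mul_pow]; simp
    rw [mul_assoc (ι K (a 0)) (ιMulti K d _), ← mul_assoc (ιMulti K d _) (ι K (b 0)), h,
      Nat.choose_succ_succ' d 1, Nat.choose_one_right]
    simp only [mul_smul_comm, smul_mul_assoc, smul_smul, mul_assoc]
    congr 1
    rw [pow_add, mul_right_comm, ← mul_pow]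
    simp

/-- The linear form which reads off the coefficient in top degree. -/
def topForm (K : Type*) [CommRing K] (D : ℕ) : ExteriorAlgebra K (Fin D → K) →ₗ[K] K :=
  liftAlternating fun d =>
    if h : d = D then
      (Matrix.detRowAlternating (n := Fin D) (R := K)).domDomCongr (finCongr h.symm)
    else 0

theorem topForm_ιMulti {d D : ℕ} (h : d = D) (z : Fin d → Fin D → K) :
    topForm K D (ιMulti K d z) = (Matrix.of fun a => z (Fin.cast h.symm a)).det := by
  subst h
  rw [topForm, liftAlternating_apply_ιMulti]
  simp [Matrix.detRowAlternating]
  rfl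

end Central

end InvariantForm

/-! ### Traces of powers as antisymmetrized traces -/

namespace InvariantForm

open ExteriorAlgebra

section Expansion

variable {K : Type*} [CommRing K] {V : Type*} [AddCommGroup V] [Module K V] {n N : ℕ}

/-- The antisymmetrization of the trace of a product of `N` matrices. -/
def altTrace (K : Type*) [CommRing K] (n N : ℕ) :
    Matrix (Fin n) (Fin n) K [⋀^Fin N]→ₗ[K] K :=
  MultilinearMap.alternatization
    ((Matrix.traceLinearMap (Fin n) K K).compMultilinearMap
      (MultilinearMap.mkPiAlgebraFin K N (Matrix (Fin n) (Fin n) K)))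

theorem altTrace_apply (A : Fin N → Matrix (Fin n) (Fin n) K) :
    altTrace K n N A =
      ∑ σ : Equiv.Perm (Fin N), ((Equiv.Perm.sign σ : ℤ) : K) *
        (List.ofFn fun r => A (σ r)).prod.trace := by
  simp [altTrace, MultilinearMap.alternatization_apply, Units.smul_def]

theorem map_altTrace {K' : Type*} [CommRing K'] (φ : K →+* K')
    (A : Fin N → Matrix (Fin n) (Fin n) K) :
    φ (altTrace K n N A) = altTrace K' n N fun p => (A p).map φ := by
  simp only [altTrace_apply, map_sum, map_mul, map_intCast]
  refine Finset.sum_congr rfl fun σ _ => ?_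
  rw [AddMonoidHom.map_trace φ]
  congr 2
  have := map_list_prod (RingHom.mapMatrix (m := Fin n) φ) (List.ofFn fun r => A (σ r))
  rw [List.map_ofFn] at this
  exact this

theorem pow_apply_of_oneForms (A : Fin N → Matrix (Fin n) (Fin n) K) (v : Fin N → V)
    (X : Matrix (Fin n) (Fin n) (ExteriorAlgebra K V))
    (hX : ∀ k l, X k l = ∑ p, A p k l • ι K (v p)) (d : ℕ) (k l : Fin n) :
    (X ^ d) k l = ∑ f : Fin d → Fin N,
      (List.ofFn fun r => A (f r)).prod k l • ιMulti K d fun r => v (f r) := by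
  induction d generalizing k with
  | zero =>
    simp [Matrix.one_apply]
  | succ d ih =>
    rw [pow_succ', Matrix.mul_apply, ← Equiv.sum_comp (Fin.consEquiv fun _ : Fin (d + 1) => Fin N) fun f =>
        (List.ofFn fun r => A (f r)).prod k l • ιMulti K (d + 1) fun r => v (f r),
      Fintype.sum_prod_type]
    simp only [hX, ih, Finset.sum_mul, Fin.consEquiv_apply, List.ofFn_succ, Fin.cons_zero,
      Fin.cons_succ, List.prod_cons, ιMulti_succ_apply, Matrix.mul_apply, Finset.sum_smul,
      Finset.mul_sum]
    rw [Finset.sum_comm_cycle]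
    refine Finset.sum_congr rfl fun p _ => ?_
    rw [Finset.sum_comm]
    refine Finset.sum_congr rfl fun f _ => Finset.sum_congr rfl fun j _ => ?_
    rw [smul_mul_smul_comm]
    rfl

/-- The trace of the `N`-th power of a matrix of combinations of `N` one-forms. -/
theorem trace_pow_of_oneForms (A : Fin N → Matrix (Fin n) (Fin n) K) (v : Fin N → V)
    (X : Matrix (Fin n) (Fin n) (ExteriorAlgebra K V))
    (hX : ∀ k l, X k l = ∑ p, A p k l • ι K (v p)) :
    (X ^ N).trace = altTrace K n N A • ιMulti K N v := by
  have h1 : (X ^ N).trace = ∑ f : Fin N → Fin N,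
      (List.ofFn fun r => A (f r)).prod.trace • ιMulti K N fun r => v (f r) := by
    simp only [Matrix.trace, Matrix.diag, pow_apply_of_oneForms A v X hX, Finset.sum_smul]
    exact Finset.sum_comm
  rw [h1, altTrace_apply, Finset.sum_smul]
  have h2 : ∀ σ : Equiv.Perm (Fin N),
      (((Equiv.Perm.sign σ : ℤ) : K) * (List.ofFn fun r => A (σ r)).prod.trace) • ιMulti K N v
        = (List.ofFn fun r => A (σ r)).prod.trace • ιMulti K N fun r => v (σ r) := by
    intro σ
    have := (ιMulti K N).map_perm v σ
    change ιMulti K N (fun r => v (σ r)) = _ at this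
    rw [this, mul_comm, mul_smul, Units.smul_def, Int.cast_smul_eq_zsmul]
  simp only [h2]
  symm
  refine Finset.sum_of_injOn (fun σ : Equiv.Perm (Fin N) => (σ : Fin N → Fin N)) ?_ ?_ ?_ ?_
  · intro σ _ τ _ h
    exact DFunLike.coe_injective h
  · intro σ _; simp
  -- A choice which is not a permutation repeats a one-form and contributes zero.
  · intro f _ hf
    have hinj : ¬ Function.Injective fun r => v (f r) := by
      intro h
      apply hf
      have hb : Function.Bijective f :=
        Finite.injective_iff_bijective.1 (fun a b hab => h (by simp [hab]))
      exact ⟨Equiv.ofBijective f hb, by simp, rfl⟩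
    rw [ιMulti_eq_zero_of_not_inj hinj, smul_zero]
  · intro σ _; rfl

end Expansion

end InvariantForm

/-! ### The trace of an odd power as a polarized determinant -/

namespace InvariantForm

open ExteriorAlgebra

section TraceIdentity

variable {K : Type*} [CommRing K] {V : Type*} [AddCommGroup V] [Module K V] {n : ℕ}

/-- The square of a matrix of one-forms, with entries in the centre of the exterior algebra. -/
def wedgeSq (K : Type*) [CommRing K] [Module K V] (Y : Matrix (Fin n) (Fin n) V) :
    Matrix (Fin n) (Fin n) (Subalgebra.center K (ExteriorAlgebra K V)) :=
  Matrix.of fun k l => ∑ a, wedge K (Y k a) (Y a l)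

theorem map_ι_mul_map_ι (Y : Matrix (Fin n) (Fin n) V) :
    Y.map (ι K) * Y.map (ι K) =
      (Subalgebra.center K (ExteriorAlgebra K V)).val.toRingHom.mapMatrix (wedgeSq K Y) := by
  ext k l
  simp [Matrix.mul_apply, wedgeSq]

/-- The trace of an even power of a matrix of one-forms equals its own negative: cyclic rotation by
one factor moves a one-form past an odd number of others. The exterior algebra over a `ℚ`-algebra
has no additive torsion. -/
theorem trace_wedgeSq_pow [Algebra ℚ K] (Y : Matrix (Fin n) (Fin n) V) (k : ℕ) (hk : 1 ≤ k) :
    (wedgeSq K Y ^ k).trace = 0 := by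
  set φ := (Subalgebra.center K (ExteriorAlgebra K V)).val.toRingHom with hφ
  have hφi : Function.Injective φ := Subtype.val_injective
  obtain ⟨j, rfl⟩ : ∃ j, k = j + 1 := ⟨k - 1, by omega⟩
  set X : Matrix (Fin n) (Fin n) (ExteriorAlgebra K V) := Y.map (ι K) with hX
  have h1 : φ.mapMatrix (wedgeSq K Y ^ (j + 1)) = X * (φ.mapMatrix (wedgeSq K Y ^ j) * X) := by
    rw [map_pow, map_pow, ← map_ι_mul_map_ι, ← hX, ← sq, ← pow_mul, ← pow_mul, ← pow_succ,
      ← pow_succ']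
    congr 1
  have h2 : φ.mapMatrix (wedgeSq K Y ^ (j + 1)) = φ.mapMatrix (wedgeSq K Y ^ j) * X * X := by
    rw [map_pow, map_pow, ← map_ι_mul_map_ι, ← hX, ← sq, ← pow_mul, ← pow_mul, ← pow_succ,
      ← pow_succ]
    congr 1
  have h3 : (X * (φ.mapMatrix (wedgeSq K Y ^ j) * X)).trace
      = -(φ.mapMatrix (wedgeSq K Y ^ j) * X * X).trace := by
    rw [mul_assoc (φ.mapMatrix (wedgeSq K Y ^ j))]
    simp only [Matrix.trace, Matrix.diag, Matrix.mul_apply, Finset.mul_sum]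
    simp only [← Finset.sum_neg_distrib]
    conv_rhs => rw [Finset.sum_comm_cycle]
    refine Finset.sum_congr rfl fun c _ => Finset.sum_congr rfl fun a _ =>
      Finset.sum_congr rfl fun b _ => ?_
    have hc := Subalgebra.mem_center_iff.1 ((wedgeSq K Y ^ j) a b).2 (ι K (Y c a))
    change ι K (Y c a) * (((wedgeSq K Y ^ j) a b : ExteriorAlgebra K V) * ι K (Y b c))
      = -(((wedgeSq K Y ^ j) a b : ExteriorAlgebra K V) * (ι K (Y b c) * ι K (Y c a)))
    rw [← mul_assoc, hc, mul_assoc, ι_mul_ι_comm, mul_neg]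
  have h4 := AddMonoidHom.map_trace φ (wedgeSq K Y ^ (j + 1))
  apply hφi
  rw [map_zero, h4]
  have h5 : (φ.mapMatrix (wedgeSq K Y ^ (j + 1))).trace
      = -(φ.mapMatrix (wedgeSq K Y ^ (j + 1))).trace := by
    conv_lhs => rw [h1, h3, ← h2]
  let _ : Module ℚ (ExteriorAlgebra K V) := Module.compHom _ (algebraMap ℚ K)
  have : IsAddTorsionFree (ExteriorAlgebra K V) := IsAddTorsionFree.of_module_rat _
  exact self_eq_neg.1 h5

/-- Multiplying by `ξ` makes the odd factor `Y` central too, so that the whole trace can be computed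
with commutative matrices. -/
theorem trace_pow_mul_ι [Algebra ℚ K] (hn : 1 ≤ n) (B : Matrix (Fin n) (Fin n) K)
    (Υ : Matrix (Fin n) (Fin n) V) (Y : Matrix (Fin n) (Fin n) V)
    (hY : ∀ k l, Y k l = ∑ b, B k b • Υ b l) (ξ : V) :
    (Y.map (ι K) ^ (2 * n - 1)).trace * ι K ξ =
      (((-1) ^ (n - 1) * algebraMap K _ B.det * ∑ l,
        ((Matrix.of fun a c => ∑ b, wedge K (Υ a b) (Y b c)).updateCol l
          (fun a => wedge K (Υ a l) ξ)).det :
        Subalgebra.center K (ExteriorAlgebra K V)) : ExteriorAlgebra K V) := by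
  set S := Subalgebra.center K (ExteriorAlgebra K V) with hS
  set φ := S.val.toRingHom with hφ
  set W : Matrix (Fin n) (Fin n) S := Matrix.of fun a c => ∑ b, wedge K (Υ a b) (Y b c) with hW
  set BS : Matrix (Fin n) (Fin n) S := B.map (algebraMap K S) with hBS
  set U : Matrix (Fin n) (Fin n) S := Matrix.of fun a c => wedge K (Υ a c) ξ with hU
  set Z := wedgeSq K Y with hZ
  have hZW : Z = BS * W := by
    refine Matrix.ext fun k l => ?_
    simp only [hZ, wedgeSq, hBS, hW, Matrix.mul_apply, Matrix.of_apply, Matrix.map_apply, hY k,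
      map_sum, LinearMap.sum_apply, map_smul, LinearMap.smul_apply, Finset.mul_sum]
    rw [Finset.sum_comm]
    refine Finset.sum_congr rfl fun b _ => Finset.sum_congr rfl fun a _ => ?_
    rw [Algebra.smul_def]
  have hYU : (Matrix.of fun a c => wedge K (Y a c) ξ) = BS * U := by
    refine Matrix.ext fun k l => ?_
    simp only [hBS, hU, Matrix.mul_apply, Matrix.of_apply, Matrix.map_apply, hY k,
      map_sum, LinearMap.sum_apply, map_smul, LinearMap.smul_apply]
    refine Finset.sum_congr rfl fun b _ => ?_
    rw [Algebra.smul_def]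
  let _ : Algebra ℚ S := ((algebraMap K S).comp (algebraMap ℚ K)).toAlgebra
  have : Nonempty (Fin n) := ⟨⟨0, hn⟩⟩
  have hadj := Matrix.adjugate_eq_of_trace_pow_eq_zero Z (trace_wedgeSq_pow Y)
  rw [Fintype.card_fin] at hadj
  have h1 : (Y.map (ι K) ^ (2 * n - 1)).trace * ι K ξ
      = φ ((Matrix.of fun a c => wedge K (Y a c) ξ) * Z ^ (n - 1)).trace := by
    have : Y.map (ι K) ^ (2 * n - 1) = Y.map (ι K) * φ.mapMatrix (Z ^ (n - 1)) := by
      rw [map_pow, hZ, hφ, ← map_ι_mul_map_ι, ← sq, ← pow_mul, ← pow_succ']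
      congr 1
      omega
    rw [this]
    simp only [Matrix.trace, Matrix.diag, Matrix.mul_apply, map_sum, Finset.sum_mul]
    refine Finset.sum_congr rfl fun k _ => Finset.sum_congr rfl fun l _ => ?_
    rw [map_mul]
    have hc := (Subalgebra.mem_center_iff.1 ((Z ^ (n - 1)) l k).2 (ι K ξ))
    change ι K (Y k l) * ((Z ^ (n - 1)) l k : ExteriorAlgebra K V) * ι K ξ
      = ι K (Y k l) * ι K ξ * ((Z ^ (n - 1)) l k : ExteriorAlgebra K V)
    rw [mul_assoc, ← hc, mul_assoc]
  have hdet : BS.det = algebraMap K S B.det := by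
    rw [hBS, ← RingHom.mapMatrix_apply, ← RingHom.map_det]
  have h2 : ((Matrix.of fun a c => wedge K (Y a c) ξ) * Z ^ (n - 1)).trace
      = (-1) ^ (n - 1) * algebraMap K S B.det * ∑ l, (W.updateCol l (fun a => wedge K (Υ a l) ξ)).det := by
    -- Since `adj(BW) = adj W · adj B`, cyclicity brings `adj B` next to `B` and produces `det B`.
    -- The remaining `tr(U adj W)` is a sum of Cramer determinants.
    rw [hYU, hadj, Matrix.mul_smul, Matrix.trace_smul, hZW, Matrix.adjugate_mul_distrib,
      ← Matrix.mul_assoc, Matrix.trace_mul_comm, ← Matrix.mul_assoc, ← Matrix.mul_assoc,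
      Matrix.adjugate_mul, hdet, Matrix.smul_mul, Matrix.smul_mul, Matrix.one_mul,
      Matrix.trace_smul, Matrix.trace_mul_comm, smul_eq_mul, smul_eq_mul, mul_assoc]
    congr 2
    simp only [Matrix.trace, Matrix.diag]
    refine Finset.sum_congr rfl fun i _ => ?_
    rw [← Matrix.cramer_apply, Matrix.cramer_eq_adjugate_mulVec]
    simp [Matrix.mul_apply, Matrix.mulVec, dotProduct, hU]
  rw [h1, h2]
  rfl

end TraceIdentity

end InvariantForm

/-! ### Permanents, and a Cauchy–Binet expansion for two-forms -/

namespace InvariantForm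

section Permanents

variable {K : Type*} [CommRing K]

theorem permanent_submatrix_equiv {α β : Type*} [Fintype α] [DecidableEq α] [Fintype β]
    [DecidableEq β] (M : Matrix β β K) (e e' : α ≃ β) :
    (M.submatrix e e').permanent = M.permanent := by
  simp only [Matrix.permanent, Matrix.submatrix_apply]
  refine Fintype.sum_equiv ⟨fun σ => (e'.symm.trans σ).trans e, fun σ => (e'.trans σ).trans e.symm,
    fun σ => by ext; simp, fun σ => by ext; simp⟩ _ _ fun σ => ?_
  exact Fintype.prod_equiv e' _ _ fun i => by simp

theorem exists_equiv_of_card_fiber_eq {α β L : Type*} [Fintype α] [Fintype β] [DecidableEq L]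
    (r : α → L) (r' : β → L)
    (h : ∀ z, Fintype.card {a // r a = z} = Fintype.card {b // r' b = z}) :
    ∃ e : α ≃ β, ∀ a, r' (e a) = r a := by
  refine ⟨(Equiv.sigmaFiberEquiv r).symm.trans ((Equiv.sigmaCongrRight fun z =>
    Fintype.equivOfCardEq (h z)).trans (Equiv.sigmaFiberEquiv r')), fun a => ?_⟩
  exact ((Fintype.equivOfCardEq (h (r a))) ⟨a, rfl⟩).2

/-- The permanent of a matrix with entries read off from row and column labels depends only on
the multiplicities of the labels. -/
theorem permanent_eq_of_card_fiber_eq {α β L L' : Type*} [Fintype α] [DecidableEq α] [Fintype β]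
    [DecidableEq β] [DecidableEq L] [DecidableEq L'] (D : Matrix L L' K)
    (r : α → L) (r' : β → L) (c : α → L') (c' : β → L')
    (h : ∀ z, Fintype.card {a // r a = z} = Fintype.card {b // r' b = z})
    (h' : ∀ z, Fintype.card {a // c a = z} = Fintype.card {b // c' b = z}) :
    (D.submatrix r c).permanent = (D.submatrix r' c').permanent := by
  obtain ⟨e, he⟩ := exists_equiv_of_card_fiber_eq r r' h
  obtain ⟨e', he'⟩ := exists_equiv_of_card_fiber_eq c c' h'
  rw [← permanent_submatrix_equiv _ e e', Matrix.submatrix_submatrix]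
  congr 1
  ext a b
  simp [he, he']

/-- The matrix `B` with a column added which marks the row `l`. -/
def markRow {L : Type*} [DecidableEq L] (B : Matrix L L K) (l : L) : Matrix L (Option L) K :=
  Matrix.of fun a c => c.elim (if a = l then 1 else 0) (B a)

/-- The marked column can be matched with any row labelled `l`: the new row, or one of the rows with
`t r = l`. Exchanging two rows with the same label changes nothing, so each choice leaves the same
permanent. -/
theorem permanent_markRow {L : Type*} [DecidableEq L] (B : Matrix L L K) (l : L) {m : ℕ}
    (t s : Fin m → L) :
    ((markRow B l).submatrix (fun a : Option (Fin m) => a.elim l t) (Option.map s)).permanent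
      = (1 + (Fintype.card {r // t r = l} : K)) * (B.submatrix t s).permanent := by
  rw [Matrix.permanent, ← Equiv.sum_comp Equiv.Perm.decomposeOption.symm, Fintype.sum_prod_type]
  have h : ∀ (o : Option (Fin m)) (σ : Equiv.Perm (Fin m)),
      (∏ x, ((markRow B l).submatrix (fun a : Option (Fin m) => a.elim l t) (Option.map s))
        (Equiv.Perm.decomposeOption.symm (o, σ) x) x)
        = (if o.elim l t = l then 1 else 0) * ∏ x, (B.submatrix t s) (σ x) x := by
    intro o σ
    rw [Fintype.prod_option]
    have h1 : Equiv.Perm.decomposeOption.symm (o, σ) none = o := by simp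
    rw [h1]
    by_cases ho : o.elim l t = l
    · have h2 : ∀ y, (Equiv.swap none o y).elim l t = Option.elim y l t := by
        intro y
        rcases eq_or_ne y none with rfl | hy
        · simp [ho]
        · rcases eq_or_ne y o with rfl | hy'
          · simp [ho]
          · rw [Equiv.swap_apply_of_ne_of_ne hy hy']
      simp [markRow, ho, h2]
    · simp [markRow, ho]
  simp only [h, ← Finset.mul_sum, ← Finset.sum_mul]
  rw [Fintype.sum_option, Fintype.card_subtype]
  simp only [Option.elim, if_true, Finset.natCast_card_filter, Matrix.permanent]
  rfl

end Permanents

section OddCauchyBinet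

open ExteriorAlgebra

variable {K : Type*} [CommRing K] {V : Type*} [AddCommGroup V] [Module K V] {n : ℕ}

/-- An expansion in the style of Cauchy and Binet, for a matrix of two-forms. -/
theorem det_sum_wedge {P Q : Type*} [DecidableEq P] [DecidableEq Q] (x : P → V) (y : Q → V)
    (A : Fin n → Finset P) (A' : Fin n → Finset Q) (D : Matrix P Q K) :
    (((Matrix.of fun a c => ∑ p ∈ A a, ∑ q ∈ A' c, D p q • wedge K (x p) (y q)).det :
      Subalgebra.center K (ExteriorAlgebra K V)) : ExteriorAlgebra K V)
      = (-1 : ℤ) ^ n.choose 2 • ∑ p ∈ Fintype.piFinset A, ∑ q ∈ Fintype.piFinset A',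
        (D.submatrix p q).permanent •
          (ιMulti K n (fun a => x (p a)) * ιMulti K n (fun c => y (q c))) := by
  have h1 : ∀ σ : Equiv.Perm (Fin n),
      (∏ c, ∑ p ∈ A (σ c), ∑ q ∈ A' c, D p q • wedge K (x p) (y q))
      = ∑ p ∈ Fintype.piFinset A, ∑ q ∈ Fintype.piFinset A',
        (∏ c, D (p (σ c)) (q c)) • ∏ c, wedge K (x (p (σ c))) (y (q c)) := by
    intro σ
    rw [Finset.prod_univ_sum]
    simp only [Finset.prod_univ_sum]
    refine Finset.sum_equiv (σ.symm.arrowCongr (Equiv.refl P)).symm ?_ ?_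
    · intro p
      simp only [Fintype.mem_piFinset]
      constructor
      · intro hp a
        simpa using hp (σ.symm a)
      · intro hp a
        simpa using hp (σ a)
    · intro p _
      refine Finset.sum_congr rfl fun q _ => ?_
      simp [Finset.prod_smul]
  rw [Matrix.det_apply']
  simp only [Matrix.of_apply, h1, Finset.mul_sum]
  rw [Finset.sum_comm, Finset.smul_sum, AddSubmonoidClass.coe_finsetSum]
  refine Finset.sum_congr rfl fun p _ => ?_
  rw [Finset.sum_comm, Finset.smul_sum, AddSubmonoidClass.coe_finsetSum]
  refine Finset.sum_congr rfl fun q _ => ?_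
  rw [AddSubmonoidClass.coe_finsetSum, Matrix.permanent, Finset.sum_smul, Finset.smul_sum]
  refine Finset.sum_congr rfl fun σ _ => ?_
  have h2 := prod_wedge (K := K) (fun c => x (p (σ c))) (fun c => y (q c))
  -- Sorting the first factors costs a second `sign σ`, which cancels the one in the determinant and
  -- leaves a permanent.
  have h3 : ιMulti K n (fun c => x (p (σ c))) = _ := (ιMulti K n).map_perm (fun a => x (p a)) σ
  rw [h3] at h2
  rw [MulMemClass.coe_mul]
  have h4 : ((∏ c, D (p (σ c)) (q c)) • ∏ c, wedge K (x (p (σ c))) (y (q c)) :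
      Subalgebra.center K (ExteriorAlgebra K V)).1 = (∏ c, D (p (σ c)) (q c)) •
        ((∏ c, wedge K (x (p (σ c))) (y (q c)) :
          Subalgebra.center K (ExteriorAlgebra K V)) : ExteriorAlgebra K V) := rfl
  have h5 : ∀ z : ℤ, ((z : Subalgebra.center K (ExteriorAlgebra K V)) : ExteriorAlgebra K V) = z :=
    fun z => map_intCast (Subalgebra.center K (ExteriorAlgebra K V)).val z
  refine (congrArg₂ (· * ·) (h5 _) (h4.trans (congrArg _ h2))).trans ?_
  rcases Int.units_eq_one_or (Equiv.Perm.sign σ) with h | h <;> simp [h, smul_comm]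

end OddCauchyBinet

end InvariantForm

/-! ### Determinants with a marked column, for oriented edges -/

namespace InvariantForm

open ExteriorAlgebra

section Oriented

variable {K : Type*} [CommRing K] {n m N : ℕ}

/-- The edges which may be chosen for a column `c`, with the marked column `l`. -/
def columnChoices (j : Fin N → Fin n) (l c : Fin n) : Finset (Option (Fin N)) :=
  if c = l then {none} else (Finset.univ.filter fun p => j p = c).map Function.Embedding.some

theorem mem_columnChoices_self {j : Fin N → Fin n} {l : Fin n} {y : Option (Fin N)} :
    y ∈ columnChoices j l l ↔ y = none := by
  simp [columnChoices]

theorem mem_columnChoices_of_ne {j : Fin N → Fin n} {l c : Fin n} (h : c ≠ l)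
    {y : Option (Fin N)} : y ∈ columnChoices j l c ↔ ∃ p, j p = c ∧ some p = y := by
  simp [columnChoices, h]

/-- As `n + n = N + 1`, joint injectivity means that `p` and `q` together use every edge and the
extra form `none` exactly once. -/
theorem sum_option_eq_of_injective (hN : N + 1 = n + n) (p : Fin n → Fin N)
    (q : Fin n → Option (Fin N)) (hinj : Function.Injective (Sum.elim (some ∘ p) q))
    (φ : Fin N → ℕ) :
    ∑ y, φ y = ∑ a, φ (p a) + ∑ c, (q c).elim 0 φ := by
  have hb : Function.Bijective (Sum.elim (some ∘ p) q) :=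
    (Fintype.bijective_iff_injective_and_card _).2 ⟨hinj, by simp [hN]⟩
  have h1 := Equiv.sum_comp (Equiv.ofBijective _ hb) fun y : Option (Fin N) => y.elim 0 φ
  rw [Fintype.sum_option, Fintype.sum_sum_type] at h1
  simpa using h1.symm

/-- The edges used by `q` have one head at each vertex other than `l`. Removing these from the heads
of all edges leaves the labels `t` together with one more `l`, whatever the choice. -/
theorem card_fiber_rows (hN : N + 1 = n + n) (j : Fin N → Fin n) (t : Fin m → Fin n)
    (hj : ∀ z, Fintype.card {p // j p = z} = 1 + Fintype.card {r // t r = z}) (l : Fin n)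
    (p : Fin n → Fin N) (q : Fin n → Option (Fin N)) (hq : ∀ c, q c ∈ columnChoices j l c)
    (hinj : Function.Injective (Sum.elim (some ∘ p) q)) (z : Fin n) :
    Fintype.card {a // j (p a) = z} = Fintype.card {o : Option (Fin m) // o.elim l t = z} := by
  have h1 := sum_option_eq_of_injective hN p q hinj fun y => if j y = z then 1 else 0
  have h2 : ∀ c, (q c).elim 0 (fun y => if j y = z then 1 else 0)
      = if c = z then (if z = l then 0 else 1) else 0 := by
    intro c
    by_cases hc : c = l
    · subst hc
      rw [mem_columnChoices_self.1 (hq c)]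
      by_cases h : c = z
      · simp [h]
      · simp [h]
    · obtain ⟨y, hy, hy'⟩ := (mem_columnChoices_of_ne hc).1 (hq c)
      rw [← hy', Option.elim, hy]
      by_cases h : c = z
      · simp [← h, hc]
      · simp [h]
  have hjz := hj z
  simp only [h2, Finset.sum_ite_eq', Finset.mem_univ, if_true] at h1
  simp only [Fintype.card_subtype, Finset.card_filter, Fintype.sum_option] at hjz ⊢
  rw [hjz] at h1
  rcases eq_or_ne z l with rfl | hz
  · have h3 : (if (none : Option (Fin m)).elim z t = z then 1 else 0) = 1 := if_pos rfl
    rw [h3]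
    simp only [if_true] at h1
    exact (h1.trans (add_zero _)).symm
  · have h3 : (if (none : Option (Fin m)).elim l t = z then 1 else 0) = 0 := if_neg hz.symm
    rw [h3]
    rw [if_neg hz] at h1
    refine Nat.add_right_cancel (m := 1) (h1.symm.trans ?_)
    rw [zero_add, add_comm]
    rfl

/-- The edges used by `p` have exactly one tail at each vertex, so the edges used by `q` have the
tails `s`; the label `none` comes from the marked column. -/
theorem card_fiber_columns (hN : N + 1 = n + n) (i j : Fin N → Fin n) (s : Fin m → Fin n)
    (hi : ∀ z, Fintype.card {p // i p = z} = 1 + Fintype.card {r // s r = z}) (l : Fin n)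
    (p : Fin n → Fin N) (hp : ∀ a, i (p a) = a) (q : Fin n → Option (Fin N))
    (hq : ∀ c, q c ∈ columnChoices j l c)
    (hinj : Function.Injective (Sum.elim (some ∘ p) q)) (z : Option (Fin n)) :
    Fintype.card {c // (q c).map i = z}
      = Fintype.card {o : Option (Fin m) // o.map s = z} := by
  cases z with
  | none =>
    have h1 : ∀ c, (q c).map i = none ↔ c = l := by
      intro c
      by_cases hc : c = l
      · subst hc
        simp [mem_columnChoices_self.1 (hq c)]
      · obtain ⟨y, hy, hy'⟩ := (mem_columnChoices_of_ne hc).1 (hq c)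
        simp [← hy', hc]
    simp [h1]
  | some w =>
    have h1 := sum_option_eq_of_injective hN p q hinj fun y => if i y = w then 1 else 0
    have hiw := hi w
    have h2 : ∀ c, (q c).elim 0 (fun y => if i y = w then 1 else 0)
        = if (q c).map i = some w then 1 else 0 := by
      intro c
      cases q c <;> simp
    simp only [h2, hp, Finset.sum_ite_eq', Finset.mem_univ, if_true] at h1
    simp only [Fintype.card_subtype, Finset.card_filter, Fintype.sum_option] at hiw ⊢
    rw [hiw] at h1
    simpa using h1.symm

theorem ιMulti_mul_ιMulti_eq_zero {V : Type*} [AddCommGroup V] [Module K V] {P : Type*}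
    (y : P → V) (p q : Fin n → P) (h : ¬ Function.Injective (Sum.elim p q)) :
    (ιMulti K n fun a => y (p a)) * (ιMulti K n fun c => y (q c)) = 0 := by
  rw [ιMulti_mul_ιMulti]
  refine ιMulti_eq_zero_of_not_inj fun h' => h ?_
  have h1 : (Fin.append (fun a => y (p a)) fun c => y (q c)) ∘ finSumFinEquiv
      = y ∘ Sum.elim p q := by
    funext x
    rcases x with a | c
    · simp
    · exact Fin.append_right _ _ c
  exact Function.Injective.of_comp (h1 ▸ h'.comp finSumFinEquiv.injective)

/-- The basis one-forms indexed by the edges, together with one extra form. -/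
def edgeForm (K : Type*) [CommRing K] (N : ℕ) (y : Option (Fin N)) : Fin (N + 1) → K :=
  Pi.single (y.elim (Fin.last N) Fin.castSucc) 1

/-- The expansion of the determinant attached to the marked column `l`. -/
theorem det_marked (hN : N + 1 = n + n) (i j : Fin N → Fin n) (s t : Fin m → Fin n)
    (hi : ∀ z, Fintype.card {p // i p = z} = 1 + Fintype.card {r // s r = z})
    (hj : ∀ z, Fintype.card {p // j p = z} = 1 + Fintype.card {r // t r = z})
    (B : Matrix (Fin n) (Fin n) K) (l : Fin n) :
    (((Matrix.of fun a c => ∑ p ∈ Finset.univ.filter (fun p => i p = a),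
      ∑ q ∈ columnChoices j l c, markRow B l (j p) (q.map i) •
        wedge K (edgeForm K N (some p)) (edgeForm K N q)).det :
      Subalgebra.center K (ExteriorAlgebra K (Fin (N + 1) → K))) :
        ExteriorAlgebra K (Fin (N + 1) → K))
      = (-1 : ℤ) ^ n.choose 2 • ((1 + (Fintype.card {r // t r = l} : K)) *
          (B.submatrix t s).permanent) •
        (ιMulti K n (fun a => ∑ p ∈ Finset.univ.filter (fun p => i p = a),
            edgeForm K N (some p)) *
          ιMulti K n (fun c => ∑ q ∈ columnChoices j l c, edgeForm K N q)) := by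
  have h1 := det_sum_wedge (K := K) (fun p => edgeForm K N (some p)) (edgeForm K N)
    (fun a => Finset.univ.filter (fun p => i p = a)) (columnChoices j l)
    ((markRow B l).submatrix j (Option.map i))
  simp only [Matrix.submatrix_apply] at h1
  have h2 := (ιMulti K n).toMultilinearMap.map_sum_finset
    (fun _ p => edgeForm K N (some p)) (fun a => Finset.univ.filter (fun p => i p = a))
  have h3 := (ιMulti K n).toMultilinearMap.map_sum_finset
    (fun _ q => edgeForm K N q) (columnChoices j l)
  simp only [AlternatingMap.coe_multilinearMap] at h2 h3
  rw [h1, h2, h3, Finset.sum_mul_sum, Finset.smul_sum (r := _ * _)]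
  congr 1
  refine Finset.sum_congr rfl fun p hp => ?_
  rw [Finset.smul_sum]
  refine Finset.sum_congr rfl fun q hq => ?_
  -- In a nonzero term the multiplicities of the labels are forced, so its permanent does not depend
  -- on the term.
  by_cases hinj : Function.Injective (Sum.elim (some ∘ p) q)
  · rw [← permanent_markRow, Matrix.submatrix_submatrix]
    congr 1
    simp only [Fintype.mem_piFinset, Finset.mem_filter, Finset.mem_univ, true_and] at hp hq
    exact permanent_eq_of_card_fiber_eq _ _ _ _ _
      (card_fiber_rows hN j t hj l p q hq hinj) (card_fiber_columns hN i j s hi l p hp q hq hinj)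
  · have := ιMulti_mul_ιMulti_eq_zero (K := K) (edgeForm K N) (some ∘ p) q hinj
    simp only [Function.comp_apply] at this
    rw [this, smul_zero, smul_zero]

end Oriented

end InvariantForm

/-! ### Minors of the incidence matrix -/

namespace InvariantForm

open ExteriorAlgebra

section IncidenceMatrix

variable {K : Type*} [CommRing K] {n m N : ℕ}

/-- The incidence matrix of a bipartite graph with edges `(i p, j p)`. -/
def edgeIncidence (i j : Fin N → Fin n) : Matrix (Fin N) (Fin (N + 1)) ℤ :=
  Matrix.of fun p c => if (c : ℕ) = i p then -1 else if (c : ℕ) = n + j p then 1 else 0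

/-- The incidence matrix with column `k` deleted. -/
def edgeMinor (i j : Fin N → Fin n) (k : Fin (N + 1)) : Matrix (Fin N) (Fin N) ℤ :=
  (edgeIncidence i j).submatrix id k.succAbove

theorem sum_edgeIncidence (hN : N + 1 = n + n) (i j : Fin N → Fin n) (p : Fin N) :
    ∑ c, edgeIncidence i j p c = 0 := by
  have h : ∀ c, edgeIncidence i j p c
      = -(if c = Fin.cast hN.symm (Fin.castAdd n (i p)) then 1 else 0)
        + (if c = Fin.cast hN.symm (Fin.natAdd n (j p)) then 1 else 0) := by
    intro c
    have := (i p).2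
    simp only [edgeIncidence, Matrix.of_apply, Fin.ext_iff, Fin.val_cast, Fin.val_castAdd,
      Fin.val_natAdd]
    split_ifs <;> first | rfl | omega
  simp [h, Finset.sum_add_distrib]

/-- The transposed incidence matrix with one more column, which marks the row `w`. -/
def bordered (K : Type*) [CommRing K] (i j : Fin N → Fin n) (w : Fin (N + 1)) :
    Matrix (Fin (N + 1)) (Fin (N + 1)) K :=
  Matrix.of fun c q =>
    Fin.lastCases (motive := fun _ => K) (if c = w then 1 else 0)
      (fun p => (edgeIncidence i j p c : K)) q

/-- The rows add up to the last unit vector: each edge contributes `-1` and `1`, and the marking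
column contributes a single `1`. Replacing any one row by the sum of all rows preserves the
determinant. -/
theorem det_bordered_updateRow (hN : N + 1 = n + n) (i j : Fin N → Fin n) (w k : Fin (N + 1)) :
    ((bordered K i j w).updateRow k (Pi.single (Fin.last N) 1)).det = (bordered K i j w).det := by
  have h := Matrix.det_updateRow_sum (bordered K i j w) k fun _ => 1
  rw [one_smul] at h
  rw [← h]
  congr 2
  funext q
  rw [Finset.sum_apply]
  refine Fin.lastCases ?_ (fun p => ?_) q
  · simp [bordered]
  · have := sum_edgeIncidence hN i j p
    simp [bordered, Fin.castSucc_ne_last, ← Int.cast_sum, this]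

/-- The left side does not involve `k`, so the signed minor is the same for every deleted column. -/
theorem det_bordered (hN : N + 1 = n + n) (i j : Fin N → Fin n) (w k : Fin (N + 1)) :
    ((bordered K i j w).updateRow w (Pi.single (Fin.last N) 1)).det
      = (-1) ^ ((k : ℕ) + N) * ((edgeMinor i j k).det : K) := by
  rw [det_bordered_updateRow hN, ← det_bordered_updateRow hN i j w k, ← Matrix.adjugate_apply,
    Matrix.adjugate_fin_succ_eq_det_submatrix, Fin.val_last]
  congr 1
  rw [← Matrix.det_transpose]
  refine Eq.trans ?_ (RingHom.map_det (Int.castRingHom K) (edgeMinor i j k)).symm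
  congr 1
  ext a b
  simp [bordered, edgeMinor]

theorem sum_edgeForm_castSucc (f : Fin N → Fin n) (a : Fin n) (p : Fin N) :
    (∑ p ∈ Finset.univ.filter (fun p => f p = a), edgeForm K N (some p)) p.castSucc
      = if f p = a then 1 else 0 := by
  simp [Finset.sum_apply, edgeForm, Pi.single_apply]

theorem sum_edgeForm_last (f : Fin N → Fin n) (a : Fin n) :
    (∑ p ∈ Finset.univ.filter (fun p => f p = a), edgeForm K N (some p)) (Fin.last N) = 0 := by
  simp [Finset.sum_apply, edgeForm]

theorem sum_columnChoices_self (j : Fin N → Fin n) (l : Fin n) :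
    ∑ q ∈ columnChoices j l l, edgeForm K N q = Pi.single (Fin.last N) 1 := by
  simp [columnChoices, edgeForm]

theorem sum_columnChoices_of_ne (j : Fin N → Fin n) {l c : Fin n} (h : c ≠ l) :
    ∑ q ∈ columnChoices j l c, edgeForm K N q
      = ∑ p ∈ Finset.univ.filter (fun p => j p = c), edgeForm K N (some p) := by
  simp [columnChoices, h]

/-- The coefficient of the product of the vertex forms, with one vertex form replaced. -/
theorem topForm_vertexForms (hN : N + 1 = n + n) (i j : Fin N → Fin n) (l : Fin n)
    (k : Fin (N + 1)) :
    topForm K (N + 1)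
      (ιMulti K n (fun a => ∑ p ∈ Finset.univ.filter (fun p => i p = a), edgeForm K N (some p)) *
          ιMulti K n (fun c => ∑ q ∈ columnChoices j l c, edgeForm K N q))
      = (-1) ^ (n + k + N) * ((edgeMinor i j k).det : K) := by
  rw [ιMulti_mul_ιMulti, topForm_ιMulti hN.symm, add_assoc, pow_add (-1 : K) n, mul_assoc,
    ← det_bordered hN i j (Fin.cast hN.symm (Fin.natAdd n l)) k]
  set u : Fin n → Fin (N + 1) → K := fun a =>
    ∑ p ∈ Finset.univ.filter (fun p => i p = a), edgeForm K N (some p) with hu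
  set v : Fin n → Fin (N + 1) → K := fun c => ∑ q ∈ columnChoices j l c, edgeForm K N q with hv
  have hu' : ∀ a, u a = ∑ p ∈ Finset.univ.filter (fun p => i p = a), edgeForm K N (some p) :=
    fun _ => rfl
  have hv' : ∀ c, v c = ∑ q ∈ columnChoices j l c, edgeForm K N q := fun _ => rfl
  -- The vertex forms have coefficients `0` and `1`, while the first `n` columns of the incidence
  -- matrix have entries `-1`.
  set ε : Fin (N + 1) → K := fun c => if (c : ℕ) < n then -1 else 1 with hε
  have hprod : ∏ c, ε c = (-1) ^ n := by
    rw [← Equiv.prod_comp (finCongr hN.symm), Fin.prod_univ_add]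
    simp [hε]
  have hmat : (bordered K i j (Fin.cast hN.symm (Fin.natAdd n l))).updateRow
      (Fin.cast hN.symm (Fin.natAdd n l)) (Pi.single (Fin.last N) 1)
      = Matrix.of fun c q => ε c * (Fin.append u v (Fin.cast hN c)) q := by
    ext c q
    obtain ⟨c, rfl⟩ := (finCongr hN.symm).surjective c
    refine Fin.addCases (fun a => ?_) (fun a => ?_) c
    · have hne : (finCongr hN.symm) (Fin.castAdd n a) ≠ Fin.cast hN.symm (Fin.natAdd n l) := by
        simp [Fin.ext_iff]; omega
      rw [Matrix.updateRow_ne hne]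
      have hε' : ε ((finCongr hN.symm) (Fin.castAdd n a)) = -1 := by simp [hε]
      have happ : Fin.append u v (Fin.cast hN ((finCongr hN.symm) (Fin.castAdd n a))) = u a :=
        Fin.append_left u v a
      rw [Matrix.of_apply, hε', happ]
      refine Fin.lastCases ?_ (fun p => ?_) q
      · rw [hu', sum_edgeForm_last]
        simp only [bordered, Matrix.of_apply, Fin.lastCases_last, mul_zero]
        exact if_neg hne
      · rw [hu', sum_edgeForm_castSucc]
        simp only [bordered, edgeIncidence, Matrix.of_apply, Fin.lastCases_castSucc]
        have := a.2
        simp only [finCongr_apply, Fin.val_cast, Fin.val_castAdd, Fin.ext_iff]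
        split_ifs <;> first | omega | simp
    · have hε' : ε ((finCongr hN.symm) (Fin.natAdd n a)) = 1 := by simp [hε]
      have happ : Fin.append u v (Fin.cast hN ((finCongr hN.symm) (Fin.natAdd n a))) = v a :=
        Fin.append_right u v a
      rw [Matrix.of_apply, hε', happ, one_mul]
      rcases eq_or_ne a l with rfl | hal
      · rw [hv', sum_columnChoices_self, finCongr_apply, Matrix.updateRow_self]
      · have hne : (finCongr hN.symm) (Fin.natAdd n a) ≠ Fin.cast hN.symm (Fin.natAdd n l) := by
          simpa [Fin.ext_iff] using hal
        rw [Matrix.updateRow_ne hne, hv', sum_columnChoices_of_ne j hal]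
        refine Fin.lastCases ?_ (fun p => ?_) q
        · rw [sum_edgeForm_last]
          simp only [bordered, Matrix.of_apply, Fin.lastCases_last]
          exact if_neg hne
        · rw [sum_edgeForm_castSucc]
          simp only [bordered, edgeIncidence, Matrix.of_apply, Fin.lastCases_castSucc]
          have := (i p).2
          simp only [finCongr_apply, Fin.val_cast, Fin.val_natAdd, Fin.ext_iff]
          split_ifs <;> first | omega | simp
  have hdet := Matrix.det_mul_column ε (Matrix.of fun c => Fin.append u v (Fin.cast hN c))
  rw [hprod] at hdet
  rw [hmat]
  refine Eq.trans ?_ (congrArg _ hdet.symm)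
  rw [← mul_assoc, ← mul_pow]
  simp

end IncidenceMatrix

end InvariantForm

/-! ### The antisymmetrized trace for oriented edges -/

namespace InvariantForm

open ExteriorAlgebra

section Oriented

variable {K : Type*} [CommRing K] {n m N : ℕ}

theorem ιMulti_edgeForm_mul (N : ℕ) :
    topForm K (N + 1) (ιMulti K N (fun p => edgeForm K N (some p)) * ι K (edgeForm K N none))
      = 1 := by
  have h : ι K (edgeForm K N none) = ιMulti K 1 fun _ => edgeForm K N none := by simp
  rw [h, ιMulti_mul_ιMulti, topForm_ιMulti rfl]
  have h1 : (Matrix.of fun a : Fin (N + 1) => (Fin.append (fun p => edgeForm K N (some p))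
      (fun _ : Fin 1 => edgeForm K N none) : Fin (N + 1) → Fin (N + 1) → K) (Fin.cast rfl a)) = 1 := by
    ext a b
    rw [Matrix.of_apply, Matrix.one_eq_pi_single]
    refine Fin.addCases (fun a => ?_) (fun a => ?_) a
    · have h2 := Fin.append_left (fun p => edgeForm K N (some p))
        (fun _ : Fin 1 => edgeForm K N none) a
      exact congrFun h2 b
    · have h2 := Fin.append_right (fun p => edgeForm K N (some p))
        (fun _ : Fin 1 => edgeForm K N none) a
      refine (congrFun h2 b).trans ?_
      rw [Subsingleton.elim a 0]
      rfl
  rw [h1, Matrix.det_one]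

/-- The trace identity is applied to independent one-forms, one for each edge and one for `ξ`.
Comparing coefficients in top degree then isolates the antisymmetrized trace. -/
theorem altTrace_single_of_algebra_rat [Algebra ℚ K] (hn : 1 ≤ n) (hN : N + 1 = n + n)
    (i j : Fin N → Fin n) (s t : Fin m → Fin n)
    (hi : ∀ z, Fintype.card {p // i p = z} = 1 + Fintype.card {r // s r = z})
    (hj : ∀ z, Fintype.card {p // j p = z} = 1 + Fintype.card {r // t r = z})
    (B : Matrix (Fin n) (Fin n) K) (k : Fin (N + 1)) :
    altTrace K n N (fun p => B * Matrix.single (i p) (j p) 1)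
      = N * B.det * (B.submatrix t s).permanent *
        ((-1) ^ (n.choose 2 + k) * ((edgeMinor i j k).det : K)) := by
  set θ : Fin N → Fin (N + 1) → K := fun p => edgeForm K N (some p) with hθ
  set ξ := edgeForm K N none with hξ
  set Υ : Matrix (Fin n) (Fin n) (Fin (N + 1) → K) := Matrix.of fun a b =>
    ∑ p ∈ Finset.univ.filter (fun p => i p = a), if j p = b then θ p else 0 with hΥ
  set Y : Matrix (Fin n) (Fin n) (Fin (N + 1) → K) := Matrix.of fun a c =>
    ∑ b, B a b • Υ b c with hY
  have hY' : ∀ a c, Y a c = ∑ p ∈ Finset.univ.filter (fun p => j p = c), B a (i p) • θ p := by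
    intro a c
    simp only [hY, hΥ, Matrix.of_apply, Finset.sum_filter, Finset.smul_sum]
    rw [Finset.sum_comm]
    refine Finset.sum_congr rfl fun p _ => ?_
    simp
  have hX : ∀ a c, Y.map (ι K) a c = ∑ p, (B * Matrix.single (i p) (j p) (1 : K)) a c • ι K (θ p) := by
    intro a c
    rw [Matrix.map_apply, hY', map_sum, Finset.sum_filter]
    refine Finset.sum_congr rfl fun p _ => ?_
    by_cases h : j p = c
    · subst h; simp
    · simp [h, Ne.symm h]
  have h1 := trace_pow_mul_ι hn B Υ Y (fun _ _ => rfl) ξ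
  have hN2 : 2 * n - 1 = N := by omega
  rw [hN2, trace_pow_of_oneForms _ θ _ hX] at h1
  have h2 := congrArg (topForm K (N + 1)) h1
  rw [smul_mul_assoc, map_smul, hθ, hξ, ιMulti_edgeForm_mul, smul_eq_mul, mul_one] at h2
  rw [h2]
  have hdet : ∀ l, ((Matrix.of fun a c => ∑ b, wedge K (Υ a b) (Y b c)).updateCol l
      (fun a => wedge K (Υ a l) ξ)) = Matrix.of fun a c =>
      ∑ p ∈ Finset.univ.filter (fun p => i p = a), ∑ q ∈ columnChoices j l c,
        markRow B l (j p) (q.map i) • wedge K (edgeForm K N (some p)) (edgeForm K N q) := by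
    intro l
    refine Matrix.ext fun a c => ?_
    rcases eq_or_ne c l with rfl | hc
    · rw [Matrix.updateCol_self, Matrix.of_apply, hΥ, Matrix.of_apply, map_sum,
        LinearMap.sum_apply]
      refine Finset.sum_congr rfl fun p _ => ?_
      by_cases h : j p = c <;> simp [columnChoices, markRow, h, hθ, hξ]
    · rw [Matrix.updateCol_ne hc, Matrix.of_apply, Matrix.of_apply]
      simp only [hΥ, Matrix.of_apply, map_sum, LinearMap.sum_apply]
      rw [Finset.sum_comm]
      refine Finset.sum_congr rfl fun p _ => ?_
      rw [Finset.sum_eq_single (j p)]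
      · simp [hY', columnChoices, hc, markRow, hθ]
      · intro b _ hb
        simp [Ne.symm hb]
      · simp
  rw [Finset.sum_congr rfl fun l _ => congrArg Matrix.det (hdet l)]
  set F : Subalgebra.center K (ExteriorAlgebra K (Fin (N + 1) → K)) →ₗ[K] K :=
    (topForm K (N + 1)).comp (Subalgebra.val _).toLinearMap with hF
  have hF' : ∀ x, topForm K (N + 1) x.1 = F x := fun _ => rfl
  have h3 : ∀ x : Subalgebra.center K (ExteriorAlgebra K (Fin (N + 1) → K)),
      (-1) ^ (n - 1) * algebraMap K _ B.det * x = ((-1) ^ (n - 1) * B.det) • x := by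
    intro x
    rw [Algebra.smul_def]
    simp
  rw [h3]
  rw [hF', map_smul, map_sum]
  have h4 : ∀ l, F (Matrix.of fun a c =>
      ∑ p ∈ Finset.univ.filter (fun p => i p = a), ∑ q ∈ columnChoices j l c,
        markRow B l (j p) (q.map i) • wedge K (edgeForm K N (some p)) (edgeForm K N q)).det
      = (1 + (Fintype.card {r // t r = l} : K)) * ((B.submatrix t s).permanent *
        ((-1) ^ n.choose 2 * (-1) ^ (n + k + N) * ((edgeMinor i j k).det : K))) := by
    intro l
    rw [← hF', det_marked hN i j s t hi hj B l, map_zsmul, map_smul,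
      topForm_vertexForms hN i j l k, smul_eq_mul, zsmul_eq_mul]
    push_cast
    ring
  simp only [h4]
  -- Counting the edges by their heads: this is the origin of the factor `2n - 1`.
  have h5 : ∑ l, (1 + (Fintype.card {r // t r = l} : K)) = N := by
    have : ∀ l, (1 + (Fintype.card {r // t r = l} : K)) = ((Fintype.card {p // j p = l} : ℕ) : K) := by
      intro l; rw [hj]; push_cast; rfl
    simp only [this]
    rw [← Nat.cast_sum, ← Fintype.card_sigma, Fintype.card_congr (Equiv.sigmaFiberEquiv j)]
    simp
  rw [← Finset.sum_mul, h5, smul_eq_mul]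
  have h6 : ((-1) ^ (n - 1) * ((-1) ^ n.choose 2 * (-1) ^ (n + k + N)) : K)
      = (-1) ^ (n.choose 2 + k) := by
    rw [← pow_add, ← pow_add]
    have : n - 1 + (n.choose 2 + (n + k + N)) = n.choose 2 + k + 2 * (2 * n - 1) := by omega
    rw [this, pow_add, pow_mul]
    simp
  rw [← h6]
  ring

theorem altTrace_single_map {R R' : Type*} [CommRing R] [CommRing R'] (φ : R →+* R')
    (i j : Fin N → Fin n) (C : Matrix (Fin n) (Fin n) R) :
    altTrace R' n N (fun p => C.map φ * Matrix.single (i p) (j p) 1)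
      = φ (altTrace R n N fun p => C * Matrix.single (i p) (j p) 1) := by
  rw [map_altTrace]
  congr 1
  funext p
  rw [Matrix.map_mul]
  congr 1
  ext a b
  simp [Matrix.single_apply, apply_ite φ]

theorem permanent_map {R R' : Type*} [CommRing R] [CommRing R'] (φ : R →+* R')
    (C : Matrix (Fin m) (Fin m) R) : (C.map φ).permanent = φ C.permanent := by
  simp [Matrix.permanent]

theorem det_map {R R' : Type*} [CommRing R] [CommRing R'] (φ : R →+* R')
    (C : Matrix (Fin n) (Fin n) R) : (C.map φ).det = φ C.det := by
  rw [RingHom.map_det, RingHom.mapMatrix_apply]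

theorem det_mul_permanent_map {R R' : Type*} [CommRing R] [CommRing R'] (φ : R →+* R')
    (s t : Fin m → Fin n) (C : Matrix (Fin n) (Fin n) R) (z : ℤ) (d : ℕ) :
    N * (C.map φ).det * ((C.map φ).submatrix t s).permanent * ((-1) ^ d * (z : R'))
      = φ (N * C.det * (C.submatrix t s).permanent * ((-1) ^ d * (z : R))) := by
  rw [Matrix.submatrix_map, permanent_map, det_map]
  simp

/-- The antisymmetrized trace for rank one matrices, over an arbitrary ring. -/
theorem altTrace_single (hn : 1 ≤ n) (hN : N + 1 = n + n)
    (i j : Fin N → Fin n) (s t : Fin m → Fin n)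
    (hi : ∀ z, Fintype.card {p // i p = z} = 1 + Fintype.card {r // s r = z})
    (hj : ∀ z, Fintype.card {p // j p = z} = 1 + Fintype.card {r // t r = z})
    (B : Matrix (Fin n) (Fin n) K) (k : Fin (N + 1)) :
    altTrace K n N (fun p => B * Matrix.single (i p) (j p) 1)
      = N * B.det * (B.submatrix t s).permanent *
        ((-1) ^ (n.choose 2 + k) * ((edgeMinor i j k).det : K)) := by
  -- The generic matrix: `ℤ[x]` embeds in `ℚ[x]`, where the previous result applies, and every `B`
  -- is a specialization.
  set G : Matrix (Fin n) (Fin n) (MvPolynomial (Fin n × Fin n) ℤ) :=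
    Matrix.of fun a b => MvPolynomial.X (a, b) with hG
  have hgen : altTrace _ n N (fun p => G * Matrix.single (i p) (j p) 1)
      = N * G.det * (G.submatrix t s).permanent *
        ((-1) ^ (n.choose 2 + k) * ((edgeMinor i j k).det : MvPolynomial (Fin n × Fin n) ℤ)) := by
    refine MvPolynomial.map_injective (Int.castRingHom ℚ) Int.cast_injective ?_
    rw [← altTrace_single_map, ← det_mul_permanent_map]
    exact altTrace_single_of_algebra_rat hn hN i j s t hi hj _ k
  have hB : B = G.map (MvPolynomial.eval₂Hom (Int.castRingHom K) fun x => B x.1 x.2) := by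
    ext a b
    simp [hG]
  rw [hB, altTrace_single_map, det_mul_permanent_map, hgen]

end Oriented

end InvariantForm

/-! ### Muir's identity -/

namespace InvariantForm

section Muir

variable {K : Type*} [CommRing K] {α : Type*} [Fintype α] [DecidableEq α]

/-- The permutations which fix every point outside `U`. -/
def permsOn (U : Finset α) : Finset (Equiv.Perm α) :=
  Finset.univ.filter fun π => ∀ a, a ∉ U → π a = a

/-- The principal minor of a matrix with indices in `U`. -/
def detOn (C : Matrix α α K) (U : Finset α) : K :=
  ∑ π ∈ permsOn U, ((Equiv.Perm.sign π : ℤ) : K) * ∏ a ∈ U, C (π a) a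

/-- The permanent of the principal submatrix with indices in `U`. -/
def permOn (C : Matrix α α K) (U : Finset α) : K :=
  ∑ π ∈ permsOn U, ∏ a ∈ U, C (π a) a

/-- The restriction of a permutation to an invariant set, extended by the identity. -/
def restrict (π : Equiv.Perm α) (V : Finset α) : Equiv.Perm α :=
  if h : ∀ x, π x ∈ V ↔ x ∈ V then Equiv.Perm.ofSubtype (π.subtypePerm h) else 1

theorem mem_permsOn {U : Finset α} {π : Equiv.Perm α} :
    π ∈ permsOn U ↔ ∀ a, a ∉ U → π a = a := by
  simp [permsOn]

theorem permsOn_apply_mem_iff {U : Finset α} {π : Equiv.Perm α} (h : π ∈ permsOn U) (a : α) :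
    π a ∈ U ↔ a ∈ U := by
  rw [mem_permsOn] at h
  by_cases ha : a ∈ U
  · simp only [ha, iff_true]
    by_contra hn
    exact hn (by rw [π.injective (h _ hn)]; exact ha)
  · rw [h a ha]

theorem restrict_apply {π : Equiv.Perm α} {V : Finset α} (h : ∀ x, π x ∈ V ↔ x ∈ V) (a : α) :
    restrict π V a = if a ∈ V then π a else a := by
  rw [restrict, dif_pos h]
  split_ifs with ha
  · rw [Equiv.Perm.ofSubtype_apply_of_mem _ ha]; rfl
  · rw [Equiv.Perm.ofSubtype_apply_of_not_mem _ ha]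

theorem restrict_mem_permsOn {π : Equiv.Perm α} {V : Finset α} (h : ∀ x, π x ∈ V ↔ x ∈ V) :
    restrict π V ∈ permsOn V := by
  rw [mem_permsOn]
  intro a ha
  rw [restrict_apply h, if_neg ha]

/-- The permutations which preserve a subset `V` of `U` split into two permutations. -/
theorem sum_permsOn_mul {U V : Finset α} (hV : V ⊆ U) (F : Equiv.Perm α → Equiv.Perm α → K) :
    ∑ τ ∈ permsOn V, ∑ ρ ∈ permsOn (U \ V), F τ ρ
      = ∑ π ∈ (permsOn U).filter (fun π => ∀ x, π x ∈ V ↔ x ∈ V),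
          F (restrict π V) (restrict π (U \ V)) := by
  rw [← Finset.sum_product']
  have hpres : ∀ π ∈ permsOn U, (∀ x, π x ∈ V ↔ x ∈ V) → ∀ x, π x ∈ U \ V ↔ x ∈ U \ V := by
    intro π hπ h x
    rw [Finset.mem_sdiff, Finset.mem_sdiff, h, permsOn_apply_mem_iff hπ]
  have hmul : ∀ τ ∈ permsOn V, ∀ ρ ∈ permsOn (U \ V), ∀ a,
      (τ * ρ) a = if a ∈ V then τ a else ρ a := by
    intro τ hτ ρ hρ a
    rw [Equiv.Perm.mul_apply]
    split_ifs with ha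
    · rw [mem_permsOn.1 hρ a (by simp [ha])]
    · refine mem_permsOn.1 hτ _ fun h => ?_
      by_cases haU : a ∈ U \ V
      · exact (Finset.mem_sdiff.1 ((permsOn_apply_mem_iff hρ a).2 haU)).2 h
      · rw [mem_permsOn.1 hρ a haU] at h
        exact ha h
  have hmem : ∀ τ ∈ permsOn V, ∀ ρ ∈ permsOn (U \ V), ∀ x, (τ * ρ) x ∈ V ↔ x ∈ V := by
    intro τ hτ ρ hρ x
    rw [hmul τ hτ ρ hρ]
    split_ifs with hx
    · exact permsOn_apply_mem_iff hτ x
    · by_cases hxU : x ∈ U \ V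
      · have := (Finset.mem_sdiff.1 ((permsOn_apply_mem_iff hρ x).2 hxU)).2
        simp [this, hx]
      · rw [mem_permsOn.1 hρ x hxU]
  have hmemU : ∀ τ ∈ permsOn V, ∀ ρ ∈ permsOn (U \ V), τ * ρ ∈ permsOn U := by
    intro τ hτ ρ hρ
    rw [mem_permsOn]
    intro a ha
    rw [hmul τ hτ ρ hρ, if_neg fun h => ha (hV h)]
    exact mem_permsOn.1 hρ a fun h => ha (Finset.mem_sdiff.1 h).1
  refine Finset.sum_bij' (fun x _ => x.1 * x.2) (fun π _ => (restrict π V, restrict π (U \ V)))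
    ?_ ?_ ?_ ?_ ?_
  · intro x hx
    obtain ⟨h1, h2⟩ := Finset.mem_product.1 hx
    exact Finset.mem_filter.2 ⟨hmemU _ h1 _ h2, hmem _ h1 _ h2⟩
  · intro π hπ
    obtain ⟨h1, h2⟩ := Finset.mem_filter.1 hπ
    exact Finset.mem_product.2 ⟨restrict_mem_permsOn h2, restrict_mem_permsOn (hpres π h1 h2)⟩
  · intro x hx
    obtain ⟨h1, h2⟩ := Finset.mem_product.1 hx
    refine Prod.ext (Equiv.ext fun a => ?_) (Equiv.ext fun a => ?_)
    · dsimp only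
      rw [restrict_apply (hmem _ h1 _ h2), hmul _ h1 _ h2]
      split_ifs with ha
      · rfl
      · exact (mem_permsOn.1 h1 a ha).symm
    · dsimp only
      rw [restrict_apply (hpres _ (hmemU _ h1 _ h2) (hmem _ h1 _ h2)), hmul _ h1 _ h2]
      split_ifs with ha ha'
      · exact absurd ha' (Finset.mem_sdiff.1 ha).2
      · rfl
      · exact (mem_permsOn.1 h2 a ha).symm
  · intro π hπ
    obtain ⟨h1, h2⟩ := Finset.mem_filter.1 hπ
    refine Equiv.ext fun a => ?_
    dsimp only
    rw [hmul _ (restrict_mem_permsOn h2) _ (restrict_mem_permsOn (hpres π h1 h2)),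
      restrict_apply h2, restrict_apply (hpres π h1 h2)]
    by_cases ha : a ∈ V
    · simp [ha]
    · by_cases haU : a ∈ U
      · simp [ha, haU]
      · simp [ha, haU, mem_permsOn.1 h1 a haU]
  · intro x hx
    obtain ⟨h1, h2⟩ := Finset.mem_product.1 hx
    congr 1
    · refine Equiv.ext fun a => ?_
      rw [restrict_apply (hmem _ h1 _ h2), hmul _ h1 _ h2]
      split_ifs with ha
      · rfl
      · exact mem_permsOn.1 h1 a ha
    · refine Equiv.ext fun a => ?_
      rw [restrict_apply (hpres _ (hmemU _ h1 _ h2) (hmem _ h1 _ h2)), hmul _ h1 _ h2]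
      split_ifs with ha ha'
      · exact absurd ha' (Finset.mem_sdiff.1 ha).2
      · rfl
      · exact mem_permsOn.1 h2 a ha

/-- The orbit of a point under a permutation. -/
def orbitFinset (π : Equiv.Perm α) (r : α) : Finset α :=
  Finset.univ.filter fun a => π.SameCycle r a

theorem sign_cycleOf (π : Equiv.Perm α) (r : α) :
    (Equiv.Perm.sign (π.cycleOf r) : ℤ) = -(-1) ^ (orbitFinset π r).card := by
  by_cases h : π r = r
  · have h1 : orbitFinset π r = {r} := by
      ext a
      simp only [orbitFinset, Finset.mem_filter, Finset.mem_univ, true_and, Finset.mem_singleton]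
      constructor
      · rintro ⟨k, rfl⟩
        exact Equiv.Perm.zpow_apply_eq_self_of_apply_eq_self h k
      · rintro rfl; exact Equiv.Perm.SameCycle.refl _ _
    rw [h1, (Equiv.Perm.cycleOf_eq_one_iff π).2 h]
    simp
  · have h1 : orbitFinset π r = (π.cycleOf r).support := by
      ext a
      simp only [orbitFinset, Finset.mem_filter, Finset.mem_univ, true_and,
        Equiv.Perm.mem_support_cycleOf_iff' h]
    rw [h1, (Equiv.Perm.isCycle_cycleOf π h).sign]
    simp

/-- Let `O` be the orbit of `r`. An invariant `V` contains `O` or is disjoint from it, so `V ↦ V ∆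
O` is an involution. It multiplies `(-1)^|V|` by `(-1)^|O|` and the sign of the restriction by
`(-1)^(|O|-1)`, so the terms cancel in pairs. -/
theorem sum_sign_restrict {U : Finset α} {r : α} (hr : r ∈ U) (π : Equiv.Perm α)
    (hπ : π ∈ permsOn U) :
    ∑ V ∈ U.powerset.filter (fun V => ∀ x, π x ∈ V ↔ x ∈ V),
      (-1 : ℤ) ^ V.card * Equiv.Perm.sign (restrict π V) = 0 := by
  set O := orbitFinset π r with hO
  have hrO : r ∈ O := by simp [hO, orbitFinset, Equiv.Perm.SameCycle.refl]
  have hOpres : ∀ x, π x ∈ O ↔ x ∈ O := by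
    intro x; simp [hO, orbitFinset, Equiv.Perm.sameCycle_apply_right]
  have hsub : ∀ V : Finset α, (∀ x, π x ∈ V ↔ x ∈ V) → ∀ a ∈ O, (a ∈ V ↔ r ∈ V) := by
    intro V hV a ha
    have h1 : π.SameCycle r a := (Finset.mem_filter.1 ha).2
    obtain ⟨k, hk⟩ := h1.exists_nat_pow_eq
    have : ∀ k : ℕ, (π ^ k) r ∈ V ↔ r ∈ V := by
      intro k
      induction k with
      | zero => simp
      | succ k ih => rw [pow_succ', Equiv.Perm.mul_apply, hV, ih]
    rw [← hk, this]
  have hOU : O ⊆ U := fun a ha => (hsub U (permsOn_apply_mem_iff hπ) a ha).2 hr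
  have hsym : ∀ V : Finset α, (∀ x, π x ∈ V ↔ x ∈ V) → ∀ x, π x ∈ symmDiff V O ↔ x ∈ symmDiff V O := by
    intro V hV x
    simp only [Finset.mem_symmDiff, hV, hOpres]
  have key : ∀ V : Finset α, (∀ x, π x ∈ V ↔ x ∈ V) → r ∉ V →
      (-1 : ℤ) ^ V.card * Equiv.Perm.sign (restrict π V)
        + (-1 : ℤ) ^ (symmDiff V O).card * Equiv.Perm.sign (restrict π (symmDiff V O)) = 0 := by
    intro V hV hrV
    have hdis : Disjoint V O := by
      rw [Finset.disjoint_left]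
      intro a haV haO
      exact hrV ((hsub V hV a haO).1 haV)
    have hmul : restrict π (symmDiff V O) = restrict π V * π.cycleOf r := by
      refine Equiv.ext fun a => ?_
      rw [restrict_apply (hsym V hV), Equiv.Perm.mul_apply, Equiv.Perm.cycleOf_apply,
        restrict_apply hV]
      by_cases haO : a ∈ O
      · have h1 : π.SameCycle r a := (Finset.mem_filter.1 haO).2
        have haV : a ∉ V := fun h => (Finset.disjoint_left.1 hdis h) haO
        have : π a ∉ V := by rwa [hV]
        simp [Finset.mem_symmDiff, haO, haV, h1, this]
      · have h1 : ¬ π.SameCycle r a := fun h => haO (by simp [hO, orbitFinset, h])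
        simp [Finset.mem_symmDiff, haO, h1]
    have hcard : (symmDiff V O).card = V.card + O.card := by
      rw [hdis.symmDiff_eq_sup, Finset.sup_eq_union, Finset.card_union_of_disjoint hdis]
    rw [hmul, hcard, Equiv.Perm.sign_mul, Units.val_mul, sign_cycleOf, ← hO, pow_add]
    have : (-1 : ℤ) ^ O.card * (-1) ^ O.card = 1 := by rw [← mul_pow]; simp
    linear_combination (-(-1 : ℤ) ^ V.card * Equiv.Perm.sign (restrict π V)) * this
  refine Finset.sum_involution (fun V _ => symmDiff V O) ?_ ?_ ?_ ?_
  · intro V hV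
    obtain ⟨-, hV⟩ := Finset.mem_filter.1 hV
    by_cases hrV : r ∈ V
    · have := key (symmDiff V O) (hsym V hV) (by simp [Finset.mem_symmDiff, hrV, hrO])
      rw [symmDiff_symmDiff_cancel_right] at this
      rw [add_comm]; exact this
    · exact key V hV hrV
  · intro V _ _ h
    have := congrArg (r ∈ ·) h
    simp [Finset.mem_symmDiff, hrO] at this
  · intro V hV
    obtain ⟨h1, h2⟩ := Finset.mem_filter.1 hV
    refine Finset.mem_filter.2 ⟨Finset.mem_powerset.2 ?_, hsym V h2⟩
    intro a ha
    rcases Finset.mem_symmDiff.1 ha with h | h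
    · exact Finset.mem_powerset.1 h1 h.1
    · exact hOU h.1
  · intro V _
    exact symmDiff_symmDiff_cancel_right _ _

/-- Muir's identity between principal minors and permanents. -/
theorem sum_detOn_mul_permOn (C : Matrix α α K) {U : Finset α} (hU : U.Nonempty) :
    ∑ V ∈ U.powerset, (-1) ^ V.card * detOn C V * permOn C (U \ V) = 0 := by
  obtain ⟨r, hr⟩ := hU
  have h1 : ∀ V ∈ U.powerset, (-1) ^ V.card * detOn C V * permOn C (U \ V)
      = ∑ π ∈ (permsOn U).filter (fun π => ∀ x, π x ∈ V ↔ x ∈ V),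
        (((-1) ^ V.card * Equiv.Perm.sign (restrict π V) : ℤ) : K) * ∏ a ∈ U, C (π a) a := by
    intro V hV
    rw [Finset.mem_powerset] at hV
    have := sum_permsOn_mul hV fun τ ρ => (-1 : K) ^ V.card * (((Equiv.Perm.sign τ : ℤ) : K) *
      ∏ a ∈ V, C (τ a) a) * ∏ a ∈ U \ V, C (ρ a) a
    rw [detOn, Finset.mul_sum, permOn, Finset.sum_mul_sum, this]
    refine Finset.sum_congr rfl fun π hπ => ?_
    obtain ⟨h1, h2⟩ := Finset.mem_filter.1 hπ
    have hpres : ∀ x, π x ∈ U \ V ↔ x ∈ U \ V := by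
      intro x
      rw [Finset.mem_sdiff, Finset.mem_sdiff, h2, permsOn_apply_mem_iff h1]
    have e1 : ∏ a ∈ V, C (restrict π V a) a = ∏ a ∈ V, C (π a) a :=
      Finset.prod_congr rfl fun a ha => by rw [restrict_apply h2, if_pos ha]
    have e2 : ∏ a ∈ U \ V, C (restrict π (U \ V) a) a = ∏ a ∈ U \ V, C (π a) a :=
      Finset.prod_congr rfl fun a ha => by rw [restrict_apply hpres, if_pos ha]
    rw [e1, e2, ← Finset.prod_sdiff hV]
    push_cast
    ring
  -- Summing first over the invariant sets of a fixed `π` leaves only signs, since the product of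
  -- entries depends on `π` alone.
  rw [Finset.sum_congr rfl h1, Finset.sum_comm' (t' := permsOn U)
    (s' := fun π => U.powerset.filter (fun V => ∀ x, π x ∈ V ↔ x ∈ V))]
  · refine Finset.sum_eq_zero fun π hπ => ?_
    rw [← Finset.sum_mul, ← Int.cast_sum, sum_sign_restrict hr π hπ]
    simp
  · intro V π
    simp only [Finset.mem_filter]
    tauto

end Muir

end InvariantForm

/-! ### An identity for square-zero elements -/

namespace InvariantForm

section SquareZero

open Polynomial

/-- For `w² = 0` the factor `1 + wX` is `exp(wX)`, so the product is `exp` of the sum. Concretely,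
its derivative is `∑ w` times the product itself. -/
theorem prod_one_add_C_mul_X {S ι : Type*} [CommRing S] [IsAddTorsionFree S] (U : Finset ι)
    (w : ι → S) (hw : ∀ r, w r * w r = 0) (hsum : ∑ r ∈ U, w r = 0) :
    ∏ r ∈ U, (1 + C (w r) * X) = 1 := by
  classical
  have hder : derivative (∏ r ∈ U, (1 + C (w r) * X)) = 0 := by
    rw [derivative_prod_finset]
    have h : ∀ r ∈ U, (∏ s ∈ U.erase r, (1 + C (w s) * X)) * derivative (1 + C (w r) * X)
        = C (w r) * ∏ s ∈ U, (1 + C (w s) * X) := by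
      intro r hr
      have h1 : C (w r) * C (w r) = (0 : S[X]) := by rw [← C_mul, hw, C_0]
      rw [← Finset.mul_prod_erase U _ hr]
      simp only [derivative_add, derivative_one, derivative_C_mul, derivative_X, mul_one, zero_add]
      linear_combination (-X * ∏ s ∈ U.erase r, (1 + C (w s) * X)) * h1
    rw [Finset.sum_congr rfl h, ← Finset.sum_mul, ← map_sum, hsum, C_0, zero_mul]
  have h0 := derivative_eq_zero.1 hder
  rw [eq_C_of_natDegree_eq_zero h0, coeff_zero_eq_eval_zero, eval_prod]
  simp

/-- Because `a² = b² = 0`, one has `(1 + abX²)(1 + iaX)(1 + ibX) = 1 + i(a + b)X`. The product of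
the last two factors on the left over all `r` is `1`. Comparing coefficients of `X^|U|` in what
remains gives the identity. -/
theorem sum_prod_mul_eq {S : Type*} [CommRing S] [IsAddTorsionFree S] {ι : Type*} [DecidableEq ι]
    (i : S) (hi : i * i = -1) (U : Finset ι) (a b : ι → S) (ha : ∀ r, a r * a r = 0)
    (hb : ∀ r, b r * b r = 0) (hsum : ∑ r ∈ U, (a r + b r) = 0) :
    ∑ I ∈ U.powerset.filter (fun I => 2 * I.card = U.card), ∏ r ∈ I, a r * b r
      = i ^ U.card * ∏ r ∈ U, (a r + b r) := by
  have h1 : ∏ r ∈ U, ((1 + C (i * a r) * X) * (1 + C (i * b r) * X)) = 1 := by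
    have := prod_one_add_C_mul_X (U ×ˢ (Finset.univ : Finset Bool))
      (fun x => i * (if x.2 then a x.1 else b x.1)) (fun x => by
        split_ifs
        · linear_combination (i * i) * ha x.1
        · linear_combination (i * i) * hb x.1) (by
        rw [← Finset.mul_sum, Finset.sum_product]
        simp [hsum])
    rw [Finset.prod_product] at this
    simpa using this
  have h2 : ∏ r ∈ U, (1 + C (a r * b r) * X ^ 2) = ∏ r ∈ U, (1 + C (i * (a r + b r)) * X) := by
    refine (mul_one _).symm.trans ((congrArg _ h1.symm).trans ?_)
    rw [← Finset.prod_mul_distrib]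
    refine Finset.prod_congr rfl fun r _ => ?_
    have ha' : C (a r) * C (a r) = (0 : S[X]) := by rw [← C_mul, ha, C_0]
    have hb' : C (b r) * C (b r) = (0 : S[X]) := by rw [← C_mul, hb, C_0]
    have hi' : C i * C i = (-1 : S[X]) := by rw [← C_mul, hi, C_neg, C_1]
    simp only [C_mul, C_add]
    linear_combination (C (a r) * C (b r) * X ^ 2 * (1 + C (a r) * C (b r) * X ^ 2)) * hi'
      + (C (b r) * C i * X ^ 3 - C (b r) * C (b r) * X ^ 4) * ha' + C (a r) * C i * X ^ 3 * hb'
  rw [Finset.prod_one_add, Finset.prod_one_add] at h2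
  have h3 := congrArg (coeff · U.card) h2
  simp only [finsetSum_coeff, Finset.prod_mul_distrib, Finset.prod_const, ← map_prod, ← pow_mul,
    coeff_C_mul_X_pow] at h3
  rw [Finset.sum_filter]
  refine Eq.trans ?_ (h3.trans ?_)
  · refine Finset.sum_congr rfl fun I _ => ?_
    rw [← Finset.prod_mul_distrib]
    simp only [eq_comm]
  · rw [Finset.sum_eq_single U]
    · simp
    · intro A hA hne
      rw [if_neg]
      intro h
      exact hne (Finset.eq_of_subset_of_card_le (Finset.mem_powerset.1 hA) h.le)
    · simp

end SquareZero

end InvariantForm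

/-! ### Half-edges and the minors of flipped matrices -/

namespace InvariantForm

open ExteriorAlgebra

section HalfEdges

variable {K : Type*} [CommRing K] {n m : ℕ}

/-- The basis one-form of a half-edge. -/
def halfForm (K : Type*) [CommRing K] (h : Fin m ⊕ Fin m) : Fin (m + m) → K :=
  Pi.single (finSumFinEquiv h) 1

theorem sum_smul_halfForm_apply (c : Fin m ⊕ Fin m → K) (h : Fin m ⊕ Fin m) :
    (∑ h', c h' • halfForm K h') (finSumFinEquiv h) = c h := by
  rw [Finset.sum_apply, Finset.sum_eq_single h]
  · simp [halfForm]
  · intro b _ hb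
    simp [halfForm, hb.symm]
  · simp

/-- The coefficient of the product of all the half-edge forms in an element of the centre. -/
def topCoeff (K : Type*) [CommRing K] (m : ℕ) :
    Subalgebra.center K (ExteriorAlgebra K (Fin (m + m) → K)) →ₗ[K] K :=
  (topForm K (m + m)).comp (Subalgebra.val _).toLinearMap

theorem topCoeff_prod_wedge (a z : Fin m → Fin (m + m) → K) :
    topCoeff K m (∏ r, wedge K (a r) (z r)) = (-1) ^ m.choose 2 *
      (Matrix.of fun k h : Fin m ⊕ Fin m => Sum.elim a z k (finSumFinEquiv h)).det := by
  change topForm K (m + m) (∏ r, wedge K (a r) (z r) : Subalgebra.center K _).1 = _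
  rw [prod_wedge, ιMulti_mul_ιMulti, map_zsmul, topForm_ιMulti rfl, zsmul_eq_mul,
    ← Matrix.det_submatrix_equiv_self finSumFinEquiv]
  push_cast
  congr 2
  ext k h
  rw [Matrix.submatrix_apply, Matrix.of_apply, Matrix.of_apply]
  refine congrFun ?_ _
  cases k with
  | inl r => exact Fin.append_left a z r
  | inr r => exact Fin.append_right a z r

theorem topCoeff_prod_wedge_sum (N : Matrix (Fin m ⊕ Fin m) (Fin m ⊕ Fin m) K) :
    topCoeff K m (∏ r, wedge K (∑ h, N (Sum.inl r) h • halfForm K h)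
      (∑ h, N (Sum.inr r) h • halfForm K h)) = (-1) ^ m.choose 2 * N.det := by
  rw [topCoeff_prod_wedge]
  congr 2
  ext k h
  cases k <;> exact sum_smul_halfForm_apply _ h

/-- The forms `a` all occur already, so the components of `z` along them do not contribute: the
change of forms is block triangular. -/
theorem topCoeff_prod_wedge_mul (a b z : Fin m → Fin (m + m) → K)
    (M M' : Matrix (Fin m) (Fin m) K)
    (hz : ∀ r, z r = ∑ r', M r r' • b r' + ∑ r', M' r r' • a r') :
    topCoeff K m (∏ r, wedge K (a r) (z r))
      = M.det * topCoeff K m (∏ r, wedge K (a r) (b r)) := by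
  rw [topCoeff_prod_wedge, topCoeff_prod_wedge, mul_left_comm]
  congr 1
  have h : (Matrix.of fun k h : Fin m ⊕ Fin m => Sum.elim a z k (finSumFinEquiv h))
      = Matrix.fromBlocks 1 0 M' M *
        Matrix.of fun k h : Fin m ⊕ Fin m => Sum.elim a b k (finSumFinEquiv h) := by
    ext k h
    rw [Matrix.mul_apply, Fintype.sum_sum_type]
    cases k with
    | inl r => simp [Matrix.one_apply]
    | inr r => simp [hz, add_comm]
  rw [h, Matrix.det_mul, Matrix.det_fromBlocks_zero₁₂, Matrix.det_one, one_mul]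

theorem wedge_mul_wedge {V : Type*} [AddCommGroup V] [Module K V] (a b c d : V) :
    wedge K a b * wedge K c d = -(wedge K a c * wedge K b d) := by
  refine Subtype.ext ?_
  change ι K a * ι K b * (ι K c * ι K d) = -(ι K a * ι K c * (ι K b * ι K d))
  rw [mul_assoc, ← mul_assoc (ι K b), ι_mul_ι_comm b c]
  simp [mul_assoc]

/-- The label of a half-edge. -/
def halfLabel (E : Fin m → Fin n × Fin n) : Fin m ⊕ Fin m → Fin n :=
  Sum.elim (fun r => (E r).1) fun r => (E r).2

/-- The contraction of the forms of the half-edges in `U` with a row of `B`. -/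
def rowForm (B : Matrix (Fin n) (Fin n) K) (E : Fin m → Fin n × Fin n) (U : Finset (Fin m))
    (h : Fin m ⊕ Fin m) : Fin (m + m) → K :=
  ∑ h', (if Sum.elim id id h' ∈ U then B (halfLabel E h) (halfLabel E h') else 0) • halfForm K h'

/-- The pair `E r`, swapped if `r` lies in `A`. -/
def flipPair (E : Fin m → Fin n × Fin n) (A : Finset (Fin m)) (r : Fin m) : Fin n × Fin n :=
  if r ∈ A then (E r).swap else E r

/-- The matrix of the entries of `B` with rows indexed by the second entries and columns indexed
by the first entries of the pairs, those in `A` being swapped. -/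
def flipMatrix (B : Matrix (Fin n) (Fin n) K) (E : Fin m → Fin n × Fin n) (A : Finset (Fin m)) :
    Matrix (Fin m) (Fin m) K :=
  B.submatrix (fun r => (flipPair E A r).2) fun r => (flipPair E A r).1

theorem detOn_eq_det {α : Type*} [Fintype α] [DecidableEq α] (C : Matrix α α K) (U : Finset α) :
    detOn C U = (Matrix.of fun a b =>
      if a ∈ U then (if b ∈ U then C a b else 0) else if a = b then 1 else 0).det := by
  rw [Matrix.det_apply', detOn]
  refine Finset.sum_subset_zero_on_sdiff (Finset.subset_univ _) ?_ ?_
  · intro π hπ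
    have hπ' : ¬ ∀ a, a ∉ U → π a = a := fun h => (Finset.mem_sdiff.1 hπ).2 (mem_permsOn.2 h)
    push Not at hπ'
    obtain ⟨x, hx, hne⟩ := hπ'
    rw [Finset.prod_eq_zero (Finset.mem_univ (π⁻¹ x)), mul_zero]
    have : π⁻¹ x ≠ x := fun h => hne (by
      conv_lhs => rw [← h]
      simp)
    rw [Matrix.of_apply, show π (π⁻¹ x) = x by simp, if_neg hx, if_neg this.symm]
  · intro π hπ
    congr 1
    rw [← Finset.prod_subset (Finset.subset_univ U)]
    · refine Finset.prod_congr rfl fun a ha => ?_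
      simp [(permsOn_apply_mem_iff hπ a).2 ha, ha]
    · intro a _ ha
      simp [mem_permsOn.1 hπ a ha, ha]

/-- In each `r ∈ U` one half-edge is a factor already, and only the component of its row form along
the opposite half-edges matters. These components form the flipped matrix; reordering the half-edges
outside `A` gives the sign. -/
theorem topCoeff_flip (B : Matrix (Fin n) (Fin n) K) (E : Fin m → Fin n × Fin n)
    {U A : Finset (Fin m)} (hA : A ⊆ U) :
    topCoeff K m ((∏ r ∈ A, wedge K (halfForm K (Sum.inl r)) (rowForm B E U (Sum.inl r))) *
      (∏ r ∈ U \ A, wedge K (halfForm K (Sum.inr r)) (rowForm B E U (Sum.inr r))) *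
      ∏ r ∈ Uᶜ, wedge K (halfForm K (Sum.inl r)) (halfForm K (Sum.inr r)))
      = (-1) ^ U.card * (-1) ^ A.card * detOn (flipMatrix B E A) U * (-1) ^ m.choose 2 := by
  -- For `r ∈ U`, `τ r` is the half-edge already present and `σ r` its partner; they carry the row
  -- and the column label of `flipMatrix`.
  set τ : Fin m → Fin m ⊕ Fin m := fun r => if r ∈ U \ A then Sum.inr r else Sum.inl r with hτ
  set σ : Fin m → Fin m ⊕ Fin m := fun r => if r ∈ U \ A then Sum.inl r else Sum.inr r with hσ
  set z : Fin m → Fin (m + m) → K := fun r =>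
    if r ∈ U then rowForm B E U (τ r) else halfForm K (σ r) with hz
  have h1 : (∏ r ∈ A, wedge K (halfForm K (Sum.inl r)) (rowForm B E U (Sum.inl r))) *
      (∏ r ∈ U \ A, wedge K (halfForm K (Sum.inr r)) (rowForm B E U (Sum.inr r))) *
      (∏ r ∈ Uᶜ, wedge K (halfForm K (Sum.inl r)) (halfForm K (Sum.inr r)))
      = ∏ r, wedge K (halfForm K (τ r)) (z r) := by
    rw [← Finset.prod_mul_prod_compl U, ← Finset.prod_sdiff hA, mul_comm (∏ r ∈ U \ A, _)]
    congr 1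
    · congr 1
      · refine Finset.prod_congr rfl fun r hr => ?_
        simp [hz, hτ, hr, hA hr]
      · refine Finset.prod_congr rfl fun r hr => ?_
        have hr' := Finset.mem_sdiff.1 hr
        simp [hz, hτ, hr'.1, hr'.2]
    · refine Finset.prod_congr rfl fun r hr => ?_
      have hr' := Finset.mem_compl.1 hr
      simp [hz, hτ, hσ, hr']
  have h2 : ∏ r, wedge K (halfForm K (τ r)) (halfForm K (σ r))
      = (-1 : K) ^ (U \ A).card • ∏ r, wedge K (halfForm K (Sum.inl r)) (halfForm K (Sum.inr r)) := by
    have : ∀ r, wedge K (halfForm K (τ r)) (halfForm K (σ r))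
        = (if r ∈ U \ A then (-1 : K) else 1) •
          wedge K (halfForm K (Sum.inl r)) (halfForm K (Sum.inr r)) := by
      intro r
      by_cases hr : r ∈ U \ A
      · simp only [hτ, hσ, if_pos hr]
        rw [wedge_comm]; simp
      · simp only [hτ, hσ, if_neg hr, one_smul]
    rw [Finset.prod_congr rfl fun r _ => this r, Finset.prod_smul]
    rw [Finset.prod_ite, Finset.prod_const_one, mul_one, Finset.prod_const, Finset.filter_mem_eq_inter,
      Finset.univ_inter]
  have h3 : topCoeff K m (∏ r, wedge K (halfForm K (Sum.inl r)) (halfForm K (Sum.inr r)))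
      = (-1) ^ m.choose 2 := by
    have := topCoeff_prod_wedge_sum (1 : Matrix (Fin m ⊕ Fin m) (Fin m ⊕ Fin m) K)
    simpa [Matrix.one_apply] using this
  have hlab : ∀ r ∈ U, ∀ r' ∈ U, B (halfLabel E (τ r)) (halfLabel E (σ r'))
      = flipMatrix B E A r r' := by
    intro r hr r' hr'
    by_cases h : r ∈ A <;> by_cases h' : r' ∈ A <;>
      simp [hτ, hσ, hr, hr', h, h', halfLabel, flipMatrix, flipPair]
  rw [h1, topCoeff_prod_wedge_mul (fun r => halfForm K (τ r)) (fun r => halfForm K (σ r)) z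
    (Matrix.of fun a b =>
      if a ∈ U then (if b ∈ U then flipMatrix B E A a b else 0) else if a = b then 1 else 0)
    (Matrix.of fun a b =>
      if a ∈ U then (if b ∈ U then B (halfLabel E (τ a)) (halfLabel E (τ b)) else 0) else 0),
    ← detOn_eq_det, h2, map_smul, h3]
  · have hc : (-1 : K) ^ (U \ A).card = (-1) ^ U.card * (-1) ^ A.card := by
      rw [← Finset.card_sdiff_add_card_eq_card hA, pow_add, mul_assoc, ← mul_pow]
      simp
    rw [hc, smul_eq_mul]
    ring
  · intro r
    by_cases hr : r ∈ U
    · simp only [hz, if_pos hr, Matrix.of_apply, rowForm]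
      rw [Fintype.sum_sum_type, ← Finset.sum_add_distrib, ← Finset.sum_add_distrib]
      refine Finset.sum_congr rfl fun r' _ => ?_
      by_cases hr' : r' ∈ U
      · simp only [Sum.elim_inl, Sum.elim_inr, id_eq, hr', if_true, ← hlab r hr r' hr']
        by_cases h : r' ∈ U \ A
        · simp only [hσ, hτ, if_pos h]
        · simp only [hσ, hτ, if_neg h]
          exact add_comm _ _
      · simp [hr']
    · simp [hz, hr]

end HalfEdges

end InvariantForm

/-! ### The determinants `det B_{I,J}` as top coefficients -/

namespace InvariantForm

open ExteriorAlgebra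

section Blocks

variable {K : Type*} [CommRing K] {n m : ℕ}

/-- The half-edges of the elements of a set of `c` elements, in order. -/
noncomputable def halfEquiv (J : Finset (Fin m)) :
    Fin J.card × Fin 2 ≃ {k : Fin m ⊕ Fin m // Sum.elim id id k ∈ J} :=
  Equiv.ofBijective
    (fun a => ⟨if a.2 = 0 then Sum.inl (J.orderEmbOfFin rfl a.1)
      else Sum.inr (J.orderEmbOfFin rfl a.1), by split_ifs <;> simp⟩) (by
    constructor
    · rintro ⟨a, b⟩ ⟨a', b'⟩ h
      have h := congrArg Subtype.val h
      fin_cases b <;> fin_cases b' <;> simp at h ⊢ <;> exact h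
    · rintro ⟨k, hk⟩
      have hr : Set.range (J.orderEmbOfFin rfl) = (J : Set (Fin m)) := J.range_orderEmbOfFin rfl
      cases k with
      | inl r =>
        obtain ⟨a, ha⟩ : r ∈ Set.range (J.orderEmbOfFin rfl) := by rw [hr]; exact hk
        exact ⟨(a, 0), by simp [ha]⟩
      | inr r =>
        obtain ⟨a, ha⟩ : r ∈ Set.range (J.orderEmbOfFin rfl) := by rw [hr]; exact hk
        exact ⟨(a, 1), by simp [ha]⟩)

theorem halfEquiv_apply (J : Finset (Fin m)) (a : Fin J.card × Fin 2) :
    (halfEquiv J a : Fin m ⊕ Fin m) = if a.2 = 0 then Sum.inl (J.orderEmbOfFin rfl a.1)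
      else Sum.inr (J.orderEmbOfFin rfl a.1) := rfl

theorem prod_eq_prod_orderEmbOfFin {S : Type*} [CommMonoid S] (J : Finset (Fin m)) {c : ℕ}
    (h : J.card = c) (f : Fin m → S) : ∏ r ∈ J, f r = ∏ a, f (J.orderEmbOfFin h a) := by
  rw [← Finset.prod_image (s := Finset.univ) (g := J.orderEmbOfFin h) (f := f)
    (J.orderEmbOfFin h).injective.injOn, J.image_orderEmbOfFin_univ]

/-- Both half-edges of each element of `I` are present, so only the half-edges of `U \ I` in the row
forms count, and their coefficients form `B_{I, U∖I}`. Each `r ∈ I` gives a sign through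
`wedge_mul_wedge`. -/
theorem topCoeff_blocks (B : Matrix (Fin n) (Fin n) K) (E : Fin m → Fin n × Fin n)
    {U I : Finset (Fin m)} (hI : I ⊆ U) (hc : I.card = (U \ I).card) :
    topCoeff K m ((∏ r ∈ I, wedge K (halfForm K (Sum.inl r)) (rowForm B E U (Sum.inl r)) *
        wedge K (halfForm K (Sum.inr r)) (rowForm B E U (Sum.inr r))) *
      ∏ r ∈ Uᶜ, wedge K (halfForm K (Sum.inl r)) (halfForm K (Sum.inr r)))
      = (-1) ^ I.card * detBlock B E I (U \ I) * (-1) ^ m.choose 2 := by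
  set J := U \ I with hJ
  -- The increasing bijection from `J` to `I` moves the row forms of `I` into the empty positions
  -- `J`; values of `φ` off `J` play no role.
  obtain ⟨φ, hφ⟩ : ∃ φ : Fin m → Fin m,
      ∀ a, φ (J.orderEmbOfFin rfl a) = I.orderEmbOfFin hc a :=
    ⟨Function.extend (J.orderEmbOfFin rfl) (I.orderEmbOfFin hc) id,
      fun a => (J.orderEmbOfFin rfl).injective.extend_apply _ _ a⟩
  set N : Matrix (Fin m ⊕ Fin m) (Fin m ⊕ Fin m) K := Matrix.of fun k h =>
    if Sum.elim id id k ∈ J then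
      (if Sum.elim id id h ∈ U then B (halfLabel E (Sum.map φ φ k)) (halfLabel E h) else 0)
    else if k = h then 1 else 0 with hN
  have h1 : (∏ r ∈ I, wedge K (halfForm K (Sum.inl r)) (rowForm B E U (Sum.inl r)) *
        wedge K (halfForm K (Sum.inr r)) (rowForm B E U (Sum.inr r))) *
      ∏ r ∈ Uᶜ, wedge K (halfForm K (Sum.inl r)) (halfForm K (Sum.inr r))
      = (-1 : K) ^ I.card • ∏ r, wedge K (∑ h, N (Sum.inl r) h • halfForm K h)
          (∑ h, N (Sum.inr r) h • halfForm K h) := by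
    have hNJ : ∏ r ∈ J, wedge K (∑ h, N (Sum.inl r) h • halfForm K h)
          (∑ h, N (Sum.inr r) h • halfForm K h)
        = ∏ r ∈ I, wedge K (rowForm B E U (Sum.inl r)) (rowForm B E U (Sum.inr r)) := by
      rw [prod_eq_prod_orderEmbOfFin J rfl, prod_eq_prod_orderEmbOfFin I hc]
      refine Finset.prod_congr rfl fun a _ => ?_
      rw [← hφ]
      simp [hN, rowForm]
    have hNC : ∀ s : Finset (Fin m), Disjoint s J →
        ∏ r ∈ s, wedge K (∑ h, N (Sum.inl r) h • halfForm K h)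
          (∑ h, N (Sum.inr r) h • halfForm K h)
        = ∏ r ∈ s, wedge K (halfForm K (Sum.inl r)) (halfForm K (Sum.inr r)) := by
      intro s hs
      refine Finset.prod_congr rfl fun r hr => ?_
      have : r ∉ J := Finset.disjoint_left.1 hs hr
      simp [hN, this]
    rw [← Finset.prod_mul_prod_compl U, ← Finset.prod_sdiff hI, ← hJ, hNJ,
      hNC I (hJ ▸ Finset.disjoint_sdiff), hNC Uᶜ (Finset.disjoint_left.2 fun r hr hr' =>
        Finset.mem_compl.1 hr (Finset.mem_sdiff.1 hr').1),
      Finset.prod_congr rfl fun r _ => (wedge_mul_wedge _ _ _ _).trans (neg_one_smul K _).symm,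
      ← smul_mul_assoc]
    congr 1
    rw [Finset.prod_smul, Finset.prod_const, Finset.prod_mul_distrib,
      mul_comm (∏ r ∈ I, wedge K (rowForm _ _ _ _) _)]
  have hdet : N.det = detBlock B E I J := by
    rw [Matrix.twoBlockTriangular_det N fun k => Sum.elim id id k ∈ J]
    · have h2 : (N.toSquareBlockProp fun k => ¬ Sum.elim id id k ∈ J) = 1 := by
        ext ⟨k, hk⟩ ⟨h, hh⟩
        simp [Matrix.toSquareBlockProp, hN, hk, Matrix.one_apply]
      rw [h2, Matrix.det_one, mul_one, detBlock, dif_pos hc,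
        ← Matrix.det_submatrix_equiv_self (halfEquiv J)]
      congr 1
      ext a b
      have hk := (halfEquiv J a).2
      have hh : Sum.elim id id (halfEquiv J b : Fin m ⊕ Fin m) ∈ U :=
        (Finset.mem_sdiff.1 (halfEquiv J b).2).1
      rw [Matrix.submatrix_apply, Matrix.submatrix_apply]
      change N (halfEquiv J a) (halfEquiv J b) = _
      rw [hN, Matrix.of_apply, if_pos hk, if_pos hh, halfEquiv_apply, halfEquiv_apply, tuple, tuple]
      congr 1
      · split_ifs <;> simp [halfLabel, hφ]
      · split_ifs <;> simp [halfLabel]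
    · intro k hk h hh
      rw [hN, Matrix.of_apply, if_neg hk, if_neg]
      rintro rfl
      exact hk hh
  rw [h1, map_smul, topCoeff_prod_wedge_sum, hdet, smul_eq_mul]
  ring

end Blocks

end InvariantForm

/-! ### Sums of `det B_{I,J}` as alternating sums of flipped minors -/

namespace InvariantForm

open ExteriorAlgebra

section BlockSum

variable {K : Type*} [CommRing K] {n m : ℕ}

/-- The symmetric matrix `B` is contracted with the antisymmetric `wedge`. -/
theorem sum_wedge_rowForm (K : Type*) [CommRing K]
    [IsAddTorsionFree (Subalgebra.center K (ExteriorAlgebra K (Fin (m + m) → K)))]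
    {B : Matrix (Fin n) (Fin n) K} (hB : B.IsSymm) (E : Fin m → Fin n × Fin n)
    (U : Finset (Fin m)) :
    ∑ r ∈ U, (wedge K (halfForm K (Sum.inl r)) (rowForm B E U (Sum.inl r)) +
      wedge K (halfForm K (Sum.inr r)) (rowForm B E U (Sum.inr r))) = 0 := by
  set c : Fin m ⊕ Fin m → Fin m ⊕ Fin m → K := fun h h' =>
    if Sum.elim id id h ∈ U then
      (if Sum.elim id id h' ∈ U then B (halfLabel E h) (halfLabel E h') else 0) else 0 with hc
  have hcs : ∀ h h', c h h' = c h' h := by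
    intro h h'
    simp only [hc]
    split_ifs <;> first | rfl | exact hB.apply _ _
  have h1 : ∑ r ∈ U, (wedge K (halfForm K (Sum.inl r)) (rowForm B E U (Sum.inl r)) +
      wedge K (halfForm K (Sum.inr r)) (rowForm B E U (Sum.inr r)))
      = ∑ h, ∑ h', c h h' • wedge K (halfForm K h) (halfForm K h') := by
    have h2 : ∀ h, ∑ h', c h h' • wedge K (halfForm K h) (halfForm K h')
        = if Sum.elim id id h ∈ U then wedge K (halfForm K h) (rowForm B E U h) else 0 := by
      intro h
      by_cases hh : Sum.elim id id h ∈ U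
      · simp only [hc, if_pos hh, rowForm, map_sum, map_smul]
      · simp [hc, hh]
    rw [Finset.sum_congr rfl fun h _ => h2 h, Fintype.sum_sum_type, ← Finset.sum_add_distrib,
      ← Finset.sum_subset (Finset.subset_univ U)]
    · refine Finset.sum_congr rfl fun r hr => ?_
      simp [hr]
    · intro r _ hr
      simp [hr]
  rw [h1]
  have h3 : ∑ h, ∑ h', c h h' • wedge K (halfForm K h) (halfForm K h')
      = -∑ h, ∑ h', c h h' • wedge K (halfForm K h) (halfForm K h') := by
    conv_lhs => rw [Finset.sum_comm]
    rw [← Finset.sum_neg_distrib]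
    refine Finset.sum_congr rfl fun h _ => ?_
    rw [← Finset.sum_neg_distrib]
    refine Finset.sum_congr rfl fun h' _ => ?_
    rw [hcs, wedge_comm, smul_neg]
  exact self_eq_neg.1 h3

theorem detBlock_of_card_ne (B : Matrix (Fin n) (Fin n) K) (E : Fin m → Fin n × Fin n)
    {I J : Finset (Fin m)} (h : I.card ≠ J.card) : detBlock B E I J = 0 := dif_neg h

/-- In `sum_prod_mul_eq`, take for `a r` and `b r` the products of the two half-edge forms of `r`
with their row forms. The left side gives the blocks; expanding `∏ (a r + b r)` gives the flips. -/
theorem sum_detBlock_of_algebra [Algebra ℂ K] {B : Matrix (Fin n) (Fin n) K} (hB : B.IsSymm)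
    (E : Fin m → Fin n × Fin n) (U : Finset (Fin m)) :
    ∑ I ∈ U.powerset, detBlock B E I (U \ I)
      = (-1) ^ U.card * ∑ A ∈ U.powerset, (-1) ^ A.card * detOn (flipMatrix B E A) U := by
  let _ : Module ℚ K := Module.compHom K ((algebraMap ℂ K).comp (algebraMap ℚ ℂ))
  let _ : Module ℚ (Subalgebra.center K (ExteriorAlgebra K (Fin (m + m) → K))) :=
    Module.compHom _ ((algebraMap ℂ K).comp (algebraMap ℚ ℂ))
  have : IsAddTorsionFree (Subalgebra.center K (ExteriorAlgebra K (Fin (m + m) → K))) :=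
    IsAddTorsionFree.of_module_rat _
  set i : K := algebraMap ℂ K Complex.I with hi
  have hii : i * i = -1 := by rw [hi, ← map_mul, Complex.I_mul_I, map_neg, map_one]
  have h1 := sum_prod_mul_eq
    (algebraMap K (Subalgebra.center K (ExteriorAlgebra K (Fin (m + m) → K))) i)
    (by rw [← map_mul, hii, map_neg, map_one]; rfl) U
    (fun r => wedge K (halfForm K (Sum.inl r)) (rowForm B E U (Sum.inl r)))
    (fun r => wedge K (halfForm K (Sum.inr r)) (rowForm B E U (Sum.inr r)))
    (fun r => wedge_mul_wedge_eq_zero _ _ _) (fun r => wedge_mul_wedge_eq_zero _ _ _)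
    (sum_wedge_rowForm K hB E U)
  have h2 := congrArg (fun x => topCoeff K m
    (x * ∏ r ∈ Uᶜ, wedge K (halfForm K (Sum.inl r)) (halfForm K (Sum.inr r)))) h1
  rw [Finset.prod_add, Finset.sum_mul, map_sum, ← map_pow, ← Algebra.smul_def, smul_mul_assoc,
    map_smul, Finset.sum_mul, map_sum,
    Finset.sum_congr rfl fun A hA => topCoeff_flip B E (Finset.mem_powerset.1 hA)] at h2
  have h3 : ∀ I ∈ U.powerset.filter (fun I => 2 * I.card = U.card),
      I.card = (U \ I).card := by
    intro I hI
    rw [Finset.mem_filter, Finset.mem_powerset] at hI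
    have := Finset.card_sdiff_add_card_eq_card hI.1
    omega
  -- As `2|I| = |U|`, the sign `(-1)^|I|` is `i^|U|`, which cancels against the same power on the
  -- other side.
  have h4 : ∀ I ∈ U.powerset.filter (fun I => 2 * I.card = U.card),
      topCoeff K m ((∏ r ∈ I, wedge K (halfForm K (Sum.inl r)) (rowForm B E U (Sum.inl r)) *
        wedge K (halfForm K (Sum.inr r)) (rowForm B E U (Sum.inr r))) *
      ∏ r ∈ Uᶜ, wedge K (halfForm K (Sum.inl r)) (halfForm K (Sum.inr r)))
      = i ^ U.card * (detBlock B E I (U \ I) * (-1) ^ m.choose 2) := by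
    intro I hI
    rw [topCoeff_blocks B E (Finset.mem_powerset.1 (Finset.mem_filter.1 hI).1) (h3 I hI),
      ← (Finset.mem_filter.1 hI).2, pow_mul, sq, hii, mul_assoc]
  rw [Finset.sum_congr rfl h4, ← Finset.mul_sum, smul_eq_mul, ← Finset.sum_mul] at h2
  have h5 : ∑ I ∈ U.powerset.filter (fun I => 2 * I.card = U.card), detBlock B E I (U \ I)
      = ∑ I ∈ U.powerset, detBlock B E I (U \ I) := by
    refine Finset.sum_filter_of_ne fun I hI hne => ?_
    by_contra h
    refine hne (detBlock_of_card_ne B E fun h' => h ?_)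
    have := Finset.card_sdiff_add_card_eq_card (Finset.mem_powerset.1 hI)
    omega
  have hu : IsUnit (i ^ U.card) := (IsUnit.of_mul_eq_one (-i) (by rw [mul_neg, hii, neg_neg])).pow _
  have hu' : IsUnit ((-1 : K) ^ m.choose 2) := (isUnit_one.neg).pow _
  rw [h5] at h2
  have h6 := hu.mul_left_cancel h2
  refine hu'.mul_right_cancel (h6.trans ?_)
  rw [Finset.mul_sum, Finset.sum_mul]
  refine Finset.sum_congr rfl fun A _ => ?_
  ring

theorem detOn_map {R R' α : Type*} [CommRing R] [CommRing R'] [Fintype α] [DecidableEq α]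
    (φ : R →+* R') (C : Matrix α α R) (U : Finset α) : detOn (C.map φ) U = φ (detOn C U) := by
  simp [detOn, map_sum, map_mul, map_prod]

theorem detBlock_map {R R' : Type*} [CommRing R] [CommRing R'] (φ : R →+* R')
    (B : Matrix (Fin n) (Fin n) R) (E : Fin m → Fin n × Fin n) (I J : Finset (Fin m)) :
    detBlock (B.map φ) E I J = φ (detBlock B E I J) := by
  unfold detBlock
  split_ifs
  · rw [Matrix.submatrix_map, RingHom.map_det, RingHom.mapMatrix_apply]
  · rw [map_zero]

theorem sum_detBlock_map {R R' : Type*} [CommRing R] [CommRing R'] (φ : R →+* R')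
    (B : Matrix (Fin n) (Fin n) R) (E : Fin m → Fin n × Fin n) (U : Finset (Fin m)) :
    ∑ I ∈ U.powerset, detBlock (B.map φ) E I (U \ I)
      = φ (∑ I ∈ U.powerset, detBlock B E I (U \ I)) := by
  simp only [detBlock_map, map_sum]

theorem sum_detOn_flipMatrix_map {R R' : Type*} [CommRing R] [CommRing R'] (φ : R →+* R')
    (B : Matrix (Fin n) (Fin n) R) (E : Fin m → Fin n × Fin n) (U : Finset (Fin m)) :
    (-1) ^ U.card * ∑ A ∈ U.powerset, (-1) ^ A.card * detOn (flipMatrix (B.map φ) E A) U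
      = φ ((-1) ^ U.card * ∑ A ∈ U.powerset, (-1) ^ A.card * detOn (flipMatrix B E A) U) := by
  have h : ∀ A, flipMatrix (B.map φ) E A = (flipMatrix B E A).map φ := fun _ => rfl
  simp [h, detOn_map]

theorem sum_detBlock {B : Matrix (Fin n) (Fin n) K} (hB : B.IsSymm)
    (E : Fin m → Fin n × Fin n) (U : Finset (Fin m)) :
    ∑ I ∈ U.powerset, detBlock B E I (U \ I)
      = (-1) ^ U.card * ∑ A ∈ U.powerset, (-1) ^ A.card * detOn (flipMatrix B E A) U := by
  -- Variables indexed by unordered pairs give the generic symmetric matrix.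
  set G : Matrix (Fin n) (Fin n) (MvPolynomial (Sym2 (Fin n)) ℤ) :=
    Matrix.of fun a b => MvPolynomial.X s(a, b) with hG
  have hGs : G.IsSymm := by
    ext a b
    simp [hG, Sym2.eq_swap]
  have hgen : ∑ I ∈ U.powerset, detBlock G E I (U \ I)
      = (-1) ^ U.card * ∑ A ∈ U.powerset, (-1) ^ A.card * detOn (flipMatrix G E A) U := by
    refine MvPolynomial.map_injective (Int.castRingHom ℂ) Int.cast_injective ?_
    rw [← sum_detBlock_map, ← sum_detOn_flipMatrix_map]
    exact sum_detBlock_of_algebra (hGs.map _) E U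
  have hB' : B = G.map (MvPolynomial.eval₂Hom (Int.castRingHom K)
      (Sym2.lift ⟨fun a b => B a b, fun a b => hB.apply b a⟩)) := by
    ext a b
    simp [hG]
  rw [hB', sum_detBlock_map, sum_detOn_flipMatrix_map, hgen]

end BlockSum

end InvariantForm

/-! ### Subset convolution -/

namespace InvariantForm

section Convolution

theorem sum_powerset_inter_mul {α K : Type*} [DecidableEq α] [CommRing K] {U V : Finset α}
    (hV : V ⊆ U) (g h : Finset α → K) :
    (∑ A ∈ V.powerset, g A) * ∑ A ∈ (U \ V).powerset, h A
      = ∑ A ∈ U.powerset, g (A ∩ V) * h (A ∩ (U \ V)) := by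
  rw [Finset.sum_mul_sum, ← Finset.sum_product']
  refine Finset.sum_bij' (fun x _ => x.1 ∪ x.2) (fun A _ => (A ∩ V, A ∩ (U \ V))) ?_ ?_ ?_ ?_ ?_
  · rintro ⟨a, b⟩ hx
    simp only [Finset.mem_product, Finset.mem_powerset] at hx ⊢
    exact Finset.union_subset (hx.1.trans hV) (hx.2.trans Finset.sdiff_subset)
  · intro A _
    simp
  · rintro ⟨a, b⟩ hx
    simp only [Finset.mem_product, Finset.mem_powerset, Finset.subset_iff, Finset.mem_sdiff] at hx
    refine Prod.ext ?_ ?_ <;> ext x <;>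
      simp only [Finset.mem_inter, Finset.mem_union, Finset.mem_sdiff] <;>
      have h1 := @hx.1 x <;> have h2 := @hx.2 x <;> have h3 := @hV x <;> tauto
  · intro A hA
    have hA := Finset.mem_powerset.1 hA
    ext x
    simp only [Finset.mem_inter, Finset.mem_union, Finset.mem_sdiff]
    have := @hA x
    tauto
  · rintro ⟨a, b⟩ hx
    simp only [Finset.mem_product, Finset.mem_powerset, Finset.subset_iff, Finset.mem_sdiff] at hx
    dsimp only
    congr 2 <;> ext x <;>
      simp only [Finset.mem_inter, Finset.mem_union, Finset.mem_sdiff] <;>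
      have h1 := @hx.1 x <;> have h2 := @hx.2 x <;> have h3 := @hV x <;> tauto

/-- As `D ∅ = 1`, the relation for `U` determines the value at `U` from the values at proper
subsets. -/
theorem eq_of_convolution_eq_zero {α K : Type*} [DecidableEq α] [CommRing K]
    {D f g : Finset α → K} (hD : D ∅ = 1) (h0 : f ∅ = g ∅)
    (hf : ∀ U : Finset α, U.Nonempty → ∑ V ∈ U.powerset, D V * f (U \ V) = 0)
    (hg : ∀ U : Finset α, U.Nonempty → ∑ V ∈ U.powerset, D V * g (U \ V) = 0)
    (U : Finset α) : f U = g U := by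
  induction U using Finset.strongInduction with
  | H U ih =>
    rcases U.eq_empty_or_nonempty with rfl | hU
    · exact h0
    have h := (hf U hU).trans (hg U hU).symm
    rw [← Finset.add_sum_erase _ _ (Finset.empty_mem_powerset U),
      ← Finset.add_sum_erase _ _ (Finset.empty_mem_powerset U), Finset.sdiff_empty, hD, one_mul,
      one_mul, Finset.sum_congr rfl fun V hV => congrArg (D V * ·) (ih (U \ V) ?_)] at h
    · exact add_right_cancel h
    · rw [Finset.mem_erase, Finset.mem_powerset] at hV
      exact Finset.sdiff_ssubset hV.2 (Finset.nonempty_iff_ne_empty.2 hV.1)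

variable {K : Type*} [CommRing K] {n m : ℕ}

theorem flipMatrix_inter_apply (B : Matrix (Fin n) (Fin n) K) (E : Fin m → Fin n × Fin n)
    (A : Finset (Fin m)) {V : Finset (Fin m)} {a b : Fin m} (ha : a ∈ V) (hb : b ∈ V) :
    flipMatrix B E (A ∩ V) a b = flipMatrix B E A a b := by
  simp [flipMatrix, flipPair, ha, hb]

theorem detOn_flipMatrix_inter (B : Matrix (Fin n) (Fin n) K) (E : Fin m → Fin n × Fin n)
    (A V : Finset (Fin m)) : detOn (flipMatrix B E (A ∩ V)) V = detOn (flipMatrix B E A) V :=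
  Finset.sum_congr rfl fun _ hπ => congrArg _ <| Finset.prod_congr rfl fun a ha =>
    flipMatrix_inter_apply B E A ((permsOn_apply_mem_iff hπ a).2 ha) ha

theorem permOn_flipMatrix_inter (B : Matrix (Fin n) (Fin n) K) (E : Fin m → Fin n × Fin n)
    (A V : Finset (Fin m)) : permOn (flipMatrix B E (A ∩ V)) V = permOn (flipMatrix B E A) V :=
  Finset.sum_congr rfl fun _ hπ => Finset.prod_congr rfl fun a ha =>
    flipMatrix_inter_apply B E A ((permsOn_apply_mem_iff hπ a).2 ha) ha

/-- The alternating sum of the permanents of the flipped matrices on `U`. -/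
def altPermOn (B : Matrix (Fin n) (Fin n) K) (E : Fin m → Fin n × Fin n) (U : Finset (Fin m)) : K :=
  ∑ A ∈ U.powerset, (-1) ^ A.card * permOn (flipMatrix B E A) U

/-- A flip set of `U` splits into flip sets of `V` and `U \ V`, so after `sum_detBlock` the sum is
Muir's identity for each flipped matrix separately. -/
theorem sum_detBlock_mul_altPermOn {B : Matrix (Fin n) (Fin n) K} (hB : B.IsSymm)
    (E : Fin m → Fin n × Fin n) {U : Finset (Fin m)} (hU : U.Nonempty) :
    ∑ V ∈ U.powerset, (∑ I ∈ V.powerset, detBlock B E I (V \ I)) * altPermOn B E (U \ V) = 0 := by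
  have h : ∀ V ∈ U.powerset,
      (∑ I ∈ V.powerset, detBlock B E I (V \ I)) * altPermOn B E (U \ V)
      = ∑ A ∈ U.powerset, (-1) ^ A.card *
        ((-1) ^ V.card * detOn (flipMatrix B E A) V * permOn (flipMatrix B E A) (U \ V)) := by
    intro V hV
    rw [sum_detBlock hB, altPermOn, mul_assoc, sum_powerset_inter_mul (Finset.mem_powerset.1 hV),
      Finset.mul_sum]
    refine Finset.sum_congr rfl fun A hA => ?_
    rw [detOn_flipMatrix_inter, permOn_flipMatrix_inter]
    have hc : A.card = (A ∩ V).card + (A ∩ (U \ V)).card := by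
      rw [← Finset.card_union_of_disjoint, ← Finset.inter_union_distrib_left,
        Finset.union_sdiff_of_subset (Finset.mem_powerset.1 hV),
        Finset.inter_eq_left.2 (Finset.mem_powerset.1 hA)]
      exact Finset.disjoint_sdiff.mono Finset.inter_subset_right Finset.inter_subset_right
    rw [hc, pow_add]
    ring
  rw [Finset.sum_congr rfl h, Finset.sum_comm]
  refine Finset.sum_eq_zero fun A _ => ?_
  rw [← Finset.mul_sum, sum_detOn_mul_permOn _ hU, mul_zero]

end Convolution

/-! ### Sets of disjoint balanced pairs -/

section Pairings

variable {α : Type*} [DecidableEq α]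

/-- The union of the two members of an unordered pair of sets. -/
def pairUnion : Sym2 (Finset α) → Finset α :=
  Sym2.lift ⟨(· ∪ ·), Finset.union_comm⟩

theorem pairUnion_mk (I J : Finset α) : pairUnion s(I, J) = I ∪ J := rfl

/-- The members of the pair are disjoint, non-empty and of the same cardinality. -/
def IsBalanced (z : Sym2 (Finset α)) : Prop :=
  ∃ I J, z = s(I, J) ∧ I.Nonempty ∧ J.Nonempty ∧ Disjoint I J ∧ I.card = J.card

theorem isBalanced_mk {I J : Finset α} :
    IsBalanced s(I, J) ↔ I.Nonempty ∧ J.Nonempty ∧ Disjoint I J ∧ I.card = J.card := by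
  constructor
  · rintro ⟨I', J', h, hI, hJ, hd, hc⟩
    rcases Sym2.eq_iff.1 h with ⟨rfl, rfl⟩ | ⟨rfl, rfl⟩
    · exact ⟨hI, hJ, hd, hc⟩
    · exact ⟨hJ, hI, hd.symm, hc.symm⟩
  · exact fun h => ⟨I, J, rfl, h⟩

theorem IsBalanced.two_le_card {z : Sym2 (Finset α)} (h : IsBalanced z) :
    2 ≤ (pairUnion z).card := by
  obtain ⟨I, J, rfl, hI, hJ, hd, hc⟩ := h
  rw [pairUnion_mk, Finset.card_union_of_disjoint hd]
  have := hI.card_pos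
  omega

theorem IsBalanced.nonempty {z : Sym2 (Finset α)} (h : IsBalanced z) : (pairUnion z).Nonempty :=
  Finset.card_pos.1 (by have := h.two_le_card; omega)

variable [Fintype α]

open scoped Classical in
/-- The balanced pairs contained in `U`. -/
noncomputable def balancedPairs (U : Finset α) : Finset (Sym2 (Finset α)) :=
  Finset.univ.filter fun z => IsBalanced z ∧ pairUnion z ⊆ U

open scoped Classical in
/-- The sets of disjoint balanced pairs with union `U`. -/
noncomputable def pairingsOn (U : Finset α) : Finset (Finset (Sym2 (Finset α))) :=
  Finset.univ.filter fun T => (∀ z ∈ T, IsBalanced z) ∧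
    (∀ z ∈ T, ∀ w ∈ T, z ≠ w → Disjoint (pairUnion z) (pairUnion w)) ∧ T.biUnion pairUnion = U

theorem mem_balancedPairs {U : Finset α} {z : Sym2 (Finset α)} :
    z ∈ balancedPairs U ↔ IsBalanced z ∧ pairUnion z ⊆ U := by simp [balancedPairs]

theorem mem_pairingsOn {U : Finset α} {T : Finset (Sym2 (Finset α))} :
    T ∈ pairingsOn U ↔ (∀ z ∈ T, IsBalanced z) ∧
      (∀ z ∈ T, ∀ w ∈ T, z ≠ w → Disjoint (pairUnion z) (pairUnion w)) ∧
      T.biUnion pairUnion = U := by simp [pairingsOn]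

theorem erase_mem_pairingsOn {U : Finset α} {T : Finset (Sym2 (Finset α))}
    (hT : T ∈ pairingsOn U) {z : Sym2 (Finset α)} (hz : z ∈ T) :
    T.erase z ∈ pairingsOn (U \ pairUnion z) := by
  rw [mem_pairingsOn] at hT ⊢
  refine ⟨fun w hw => hT.1 w (Finset.mem_of_mem_erase hw), fun w hw w' hw' =>
    hT.2.1 w (Finset.mem_of_mem_erase hw) w' (Finset.mem_of_mem_erase hw'), ?_⟩
  rw [← hT.2.2]
  ext x
  simp only [Finset.mem_biUnion, Finset.mem_sdiff, Finset.mem_erase]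
  constructor
  · rintro ⟨w, ⟨hne, hw⟩, hx⟩
    exact ⟨⟨w, hw, hx⟩, Finset.disjoint_left.1 (hT.2.1 w hw z hz hne) hx⟩
  · rintro ⟨⟨w, hw, hx⟩, hxz⟩
    exact ⟨w, ⟨by rintro rfl; exact hxz hx, hw⟩, hx⟩

theorem notMem_of_mem_pairingsOn {U : Finset α} {z : Sym2 (Finset α)} (hz : IsBalanced z)
    {T : Finset (Sym2 (Finset α))} (hT : T ∈ pairingsOn (U \ pairUnion z)) : z ∉ T := by
  intro h
  obtain ⟨x, hx⟩ := hz.nonempty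
  have : x ∈ U \ pairUnion z := by
    rw [← (mem_pairingsOn.1 hT).2.2]
    exact Finset.mem_biUnion.2 ⟨z, h, hx⟩
  exact (Finset.mem_sdiff.1 this).2 hx

theorem insert_mem_pairingsOn {U : Finset α} {z : Sym2 (Finset α)} (hz : z ∈ balancedPairs U)
    {T : Finset (Sym2 (Finset α))} (hT : T ∈ pairingsOn (U \ pairUnion z)) :
    insert z T ∈ pairingsOn U := by
  rw [mem_balancedPairs] at hz
  rw [mem_pairingsOn] at hT ⊢
  have hd : ∀ w ∈ T, Disjoint (pairUnion z) (pairUnion w) := by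
    intro w hw
    refine (Finset.disjoint_sdiff (s := pairUnion z) (t := U)).mono_right ?_
    rw [← hT.2.2]
    exact Finset.subset_biUnion_of_mem pairUnion hw
  refine ⟨?_, ?_, ?_⟩
  · intro w hw
    rcases Finset.mem_insert.1 hw with rfl | hw
    · exact hz.1
    · exact hT.1 w hw
  · intro w hw w' hw' hne
    rcases Finset.mem_insert.1 hw with rfl | h <;> rcases Finset.mem_insert.1 hw' with rfl | h'
    · exact absurd rfl hne
    · exact hd w' h'
    · exact (hd w h).symm
    · exact hT.2.1 w h w' h' hne
  · rw [Finset.biUnion_insert, hT.2.2, Finset.union_sdiff_of_subset hz.2]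

/-- Removing a distinguished pair is reversible: a balanced pair is non-empty, so it cannot occur
again in the rest. -/
theorem sum_pairingsOn_sum {K : Type*} [AddCommMonoid K] (U : Finset α)
    (G : Sym2 (Finset α) → Finset (Sym2 (Finset α)) → K) :
    ∑ T ∈ pairingsOn U, ∑ z ∈ T, G z (T.erase z)
      = ∑ z ∈ balancedPairs U, ∑ T ∈ pairingsOn (U \ pairUnion z), G z T := by
  rw [Finset.sum_sigma', Finset.sum_sigma']
  refine Finset.sum_bij' (fun x _ => ⟨x.2, x.1.erase x.2⟩) (fun x _ => ⟨insert x.1 x.2, x.1⟩)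
    ?_ ?_ ?_ ?_ ?_
  · rintro ⟨T, z⟩ hx
    obtain ⟨hT, hz⟩ := Finset.mem_sigma.1 hx
    refine Finset.mem_sigma.2 ⟨mem_balancedPairs.2 ⟨(mem_pairingsOn.1 hT).1 z hz, ?_⟩,
      erase_mem_pairingsOn hT hz⟩
    rw [← (mem_pairingsOn.1 hT).2.2]
    exact Finset.subset_biUnion_of_mem pairUnion hz
  · rintro ⟨z, T⟩ hx
    obtain ⟨hz, hT⟩ := Finset.mem_sigma.1 hx
    exact Finset.mem_sigma.2 ⟨insert_mem_pairingsOn hz hT, Finset.mem_insert_self _ _⟩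
  · rintro ⟨T, z⟩ hx
    simp [Finset.insert_erase (Finset.mem_sigma.1 hx).2]
  · rintro ⟨z, T⟩ hx
    obtain ⟨hz, hT⟩ := Finset.mem_sigma.1 hx
    simp [Finset.erase_insert (notMem_of_mem_pairingsOn (mem_balancedPairs.1 hz).1 hT)]
  · intro _ _
    rfl

end Pairings

end InvariantForm

/-! ### The polynomial `Σ` as an alternating sum of permanents -/

namespace InvariantForm

section SigmaOn

variable {K : Type*} [CommRing K] {n m : ℕ}

/-- The polynomial `Σ` for the pairs with positions in `U`. -/
noncomputable def SigmaOn {B : Matrix (Fin n) (Fin n) K} (hB : B.IsSymm) (E : Fin m → Fin n × Fin n)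
    (U : Finset (Fin m)) : K :=
  ∑ T ∈ pairingsOn U, (-2) ^ T.card * (T.card.factorial : K) * ∏ z ∈ T, pairDet hB E z

/-- The factor `2` counts the orders `(I, J)` and `(J, I)`, which differ since `I` and `J` are
disjoint and non-empty. -/
theorem sum_detBlock_eq_two_mul {B : Matrix (Fin n) (Fin n) K} (hB : B.IsSymm)
    (E : Fin m → Fin n × Fin n) {V : Finset (Fin m)} (hV : V.Nonempty) :
    ∑ I ∈ V.powerset, detBlock B E I (V \ I)
      = 2 * ∑ z ∈ (balancedPairs V).filter (fun z => pairUnion z = V), pairDet hB E z := by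
  have hc : ∀ I ⊆ V, I.card = (V \ I).card → IsBalanced s(I, V \ I) := by
    intro I hI h
    have h1 := Finset.card_sdiff_add_card_eq_card hI
    have h2 := hV.card_pos
    exact isBalanced_mk.2 ⟨Finset.card_pos.1 (by omega), Finset.card_pos.1 (by omega),
      Finset.disjoint_sdiff, h⟩
  rw [← Finset.sum_filter_of_ne (p := fun I => I.card = (V \ I).card) fun I _ hne => by
      by_contra h
      exact hne (detBlock_of_card_ne B E h),
    ← Finset.sum_fiberwise_of_maps_to
      (g := fun I => s(I, V \ I)) (t := (balancedPairs V).filter (fun z => pairUnion z = V)),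
    Finset.mul_sum]
  · refine Finset.sum_congr rfl fun z hz => ?_
    rw [Finset.mem_filter, mem_balancedPairs] at hz
    obtain ⟨⟨⟨I, J, rfl, hI, hJ, hd, hcard⟩, -⟩, hU⟩ := hz
    rw [pairUnion_mk] at hU
    have hJI : V \ I = J := by rw [← hU, Finset.union_sdiff_cancel_left hd]
    have hIJ : V \ J = I := by rw [← hU, Finset.union_sdiff_cancel_right hd]
    have hne : I ≠ J := by
      rintro rfl
      exact hI.ne_empty (disjoint_self.1 hd)
    have hf : ((V.powerset.filter fun I => I.card = (V \ I).card).filter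
        fun I' => s(I', V \ I') = s(I, J)) = {I, J} := by
      ext I'
      simp only [Finset.mem_filter, Finset.mem_powerset, Finset.mem_insert, Finset.mem_singleton,
        Sym2.eq_iff]
      constructor
      · rintro ⟨-, ⟨h, -⟩ | ⟨h, -⟩⟩
        · exact Or.inl h
        · exact Or.inr h
      · rintro (rfl | rfl)
        · exact ⟨⟨hU ▸ Finset.subset_union_left, by rw [hJI, hcard]⟩, Or.inl ⟨rfl, hJI⟩⟩
        · exact ⟨⟨hU ▸ Finset.subset_union_right, by rw [hIJ, hcard]⟩, Or.inr ⟨rfl, hIJ⟩⟩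
    rw [hf, Finset.sum_pair hne, hJI, hIJ, detBlock_comm hB E J I, ← two_mul]
    rfl
  · intro I hI
    rw [Finset.mem_filter, Finset.mem_powerset] at hI
    have hu : pairUnion s(I, V \ I) = V := Finset.union_sdiff_of_subset hI.1
    exact Finset.mem_filter.2 ⟨mem_balancedPairs.2 ⟨hc I hI.1 hI.2, hu.le⟩, hu⟩

theorem sum_detBlock_empty (B : Matrix (Fin n) (Fin n) K) (E : Fin m → Fin n × Fin n) :
    ∑ I ∈ (∅ : Finset (Fin m)).powerset, detBlock B E I (∅ \ I) = 1 := by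
  rw [Finset.powerset_empty, Finset.sum_singleton, detBlock, dif_pos (by simp)]
  have : IsEmpty (Fin ((∅ : Finset (Fin m)) \ ∅).card) := by
    rw [Finset.empty_sdiff, Finset.card_empty]
    infer_instance
  exact Matrix.det_isEmpty

/-- The weight satisfies `(-2)^k k! = k · (-2) · (-2)^(k-1) (k-1)!`, and the factor `k` is the
number of ways to distinguish one pair. -/
theorem SigmaOn_eq_neg_sum {B : Matrix (Fin n) (Fin n) K} (hB : B.IsSymm)
    (E : Fin m → Fin n × Fin n) {U : Finset (Fin m)} (hU : U.Nonempty) :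
    SigmaOn hB E U = -∑ z ∈ balancedPairs U, 2 * (pairDet hB E z * SigmaOn hB E (U \ pairUnion z)) := by
  have h : ∀ T ∈ pairingsOn U,
      (-2) ^ T.card * (T.card.factorial : K) * ∏ z ∈ T, pairDet hB E z
      = ∑ z ∈ T, -2 * (pairDet hB E z * ((-2) ^ (T.erase z).card *
          ((T.erase z).card.factorial : K) * ∏ z ∈ T.erase z, pairDet hB E z)) := by
    intro T hT
    have hne : T.Nonempty := by
      rw [Finset.nonempty_iff_ne_empty]
      rintro rfl
      rw [← (mem_pairingsOn.1 hT).2.2] at hU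
      simp at hU
    obtain ⟨c, hc⟩ : ∃ c, T.card = c + 1 := ⟨T.card - 1, by have := hne.card_pos; omega⟩
    have h1 : ∀ z ∈ T, -2 * (pairDet hB E z * ((-2) ^ (T.erase z).card *
          ((T.erase z).card.factorial : K) * ∏ z ∈ T.erase z, pairDet hB E z))
        = -2 * ((-2) ^ c * (c.factorial : K) * ∏ z ∈ T, pairDet hB E z) := by
      intro z hz
      rw [Finset.card_erase_of_mem hz, hc, Nat.add_sub_cancel, ← Finset.mul_prod_erase T _ hz]
      ring
    rw [Finset.sum_congr rfl h1, Finset.sum_const, nsmul_eq_mul, hc, Nat.factorial_succ]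
    push_cast
    ring
  rw [SigmaOn, Finset.sum_congr rfl h, sum_pairingsOn_sum U fun z T =>
    -2 * (pairDet hB E z * ((-2) ^ T.card * (T.card.factorial : K) * ∏ z ∈ T, pairDet hB E z)),
    ← Finset.sum_neg_distrib]
  refine Finset.sum_congr rfl fun z _ => ?_
  rw [SigmaOn, ← Finset.mul_sum, ← Finset.mul_sum, neg_mul]

theorem SigmaOn_empty {B : Matrix (Fin n) (Fin n) K} (hB : B.IsSymm) (E : Fin m → Fin n × Fin n) :
    SigmaOn hB E ∅ = 1 := by
  have h : pairingsOn (∅ : Finset (Fin m)) = {∅} := by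
    ext T
    rw [Finset.mem_singleton]
    constructor
    · intro hT
      rw [mem_pairingsOn] at hT
      rw [Finset.eq_empty_iff_forall_notMem]
      intro z hz
      obtain ⟨x, hx⟩ := (hT.1 z hz).nonempty
      have : x ∈ (∅ : Finset (Fin m)) := by
        rw [← hT.2.2]
        exact Finset.mem_biUnion.2 ⟨z, hz, hx⟩
      simp at this
    · rintro rfl
      simp [mem_pairingsOn]
  simp [SigmaOn, h]

theorem sum_detBlock_mul_SigmaOn {B : Matrix (Fin n) (Fin n) K} (hB : B.IsSymm)
    (E : Fin m → Fin n × Fin n) {U : Finset (Fin m)} (hU : U.Nonempty) :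
    ∑ V ∈ U.powerset, (∑ I ∈ V.powerset, detBlock B E I (V \ I)) * SigmaOn hB E (U \ V) = 0 := by
  rw [← Finset.add_sum_erase _ _ (Finset.empty_mem_powerset U), sum_detBlock_empty, one_mul,
    Finset.sdiff_empty, SigmaOn_eq_neg_sum hB E hU, neg_add_eq_zero,
    ← Finset.sum_fiberwise_of_maps_to (g := pairUnion) (t := U.powerset.erase ∅)]
  · refine Finset.sum_congr rfl fun V hV => ?_
    rw [Finset.mem_erase, Finset.mem_powerset] at hV
    rw [sum_detBlock_eq_two_mul hB E (Finset.nonempty_iff_ne_empty.2 hV.1), mul_assoc,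
      Finset.sum_mul, Finset.mul_sum]
    have hf : (balancedPairs U).filter (fun z => pairUnion z = V)
        = (balancedPairs V).filter (fun z => pairUnion z = V) := by
      ext z
      simp only [Finset.mem_filter, mem_balancedPairs]
      constructor
      · rintro ⟨⟨h1, -⟩, h2⟩
        exact ⟨⟨h1, h2.le⟩, h2⟩
      · rintro ⟨⟨h1, -⟩, h2⟩
        exact ⟨⟨h1, h2.le.trans hV.2⟩, h2⟩
    rw [hf]
    refine Finset.sum_congr rfl fun z hz => ?_
    rw [(Finset.mem_filter.1 hz).2]
  · intro z hz
    rw [mem_balancedPairs] at hz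
    exact Finset.mem_erase.2 ⟨hz.1.nonempty.ne_empty, Finset.mem_powerset.2 hz.2⟩

/-- Both sides are inverse to the same function under subset convolution. -/
theorem SigmaOn_eq_altPermOn {B : Matrix (Fin n) (Fin n) K} (hB : B.IsSymm)
    (E : Fin m → Fin n × Fin n) (U : Finset (Fin m)) : SigmaOn hB E U = altPermOn B E U := by
  refine eq_of_convolution_eq_zero (D := fun V => ∑ I ∈ V.powerset, detBlock B E I (V \ I))
    (sum_detBlock_empty B E) ?_ (fun U hU => sum_detBlock_mul_SigmaOn hB E hU)
    (fun U hU => sum_detBlock_mul_altPermOn hB E hU) U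
  have h : permsOn (∅ : Finset (Fin m)) = {1} := by
    ext π
    simp [mem_permsOn, Equiv.ext_iff]
  simp [SigmaOn_empty, altPermOn, permOn, h]

theorem mem_pairingsOn_univ {T : Finset (Sym2 (Finset (Fin m)))} :
    T ∈ pairingsOn Finset.univ ↔ IsPairing T := by
  rw [mem_pairingsOn, IsPairing]
  have hmem : ∀ (z : Sym2 (Finset (Fin m))) (x : Fin m),
      x ∈ pairUnion z ↔ ∃ I, I ∈ z ∧ x ∈ I := by
    intro z x
    induction z with
    | _ I J => simp [pairUnion_mk]
  refine and_congr ?_ (and_congr ?_ ?_)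
  · constructor
    · exact fun h I J hz => isBalanced_mk.1 (h _ hz)
    · intro h z hz
      induction z with
      | _ I J => exact isBalanced_mk.2 (h I J hz)
  · refine forall₅_congr fun z _ w _ _ => ?_
    constructor
    · intro h I J hI hJ
      rw [Finset.disjoint_left] at h ⊢
      exact fun x hx hx' => h ((hmem z x).2 ⟨I, hI, hx⟩) ((hmem w x).2 ⟨J, hJ, hx'⟩)
    · intro h
      rw [Finset.disjoint_left]
      intro x hx hx'
      obtain ⟨I, hI, hxI⟩ := (hmem z x).1 hx
      obtain ⟨J, hJ, hxJ⟩ := (hmem w x).1 hx'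
      exact Finset.disjoint_left.1 (h I J hI hJ) hxI hxJ
  · rw [Finset.eq_univ_iff_forall]
    refine forall_congr' fun x => ?_
    simp only [Finset.mem_biUnion, hmem]

theorem two_mul_card_le_of_mem_pairingsOn {U : Finset (Fin m)}
    {T : Finset (Sym2 (Finset (Fin m)))} (hT : T ∈ pairingsOn U) : 2 * T.card ≤ U.card := by
  rw [mem_pairingsOn] at hT
  rw [← hT.2.2, Finset.card_biUnion hT.2.1, mul_comm, ← smul_eq_mul]
  exact Finset.card_nsmul_le_sum _ _ _ fun z hz => (hT.1 z hz).two_le_card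

/-- For `m ≥ 1` the empty pairing does not cover, so starting the sum at `k = 1` loses nothing;
pairs have at least two elements, whence `k ≤ m / 2`. -/
theorem Sigma_eq_SigmaOn_univ (hm : 1 ≤ m) {B : Matrix (Fin n) (Fin n) K} (hB : B.IsSymm)
    (E : Fin m → Fin n × Fin n) : Sigma hB E = SigmaOn hB E Finset.univ := by
  rw [Sigma, SigmaOn, ← Finset.sum_fiberwise_of_maps_to
    (g := Finset.card) (t := Finset.Icc 1 (m / 2))]
  · refine Finset.sum_congr rfl fun k _ => ?_
    have hf : (pairingsOn (Finset.univ : Finset (Fin m))).filter (fun T => T.card = k)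
        = pairings m k := by
      ext T
      simp [mem_pairingsOn_univ, pairings, and_comm]
    rw [hf, Finset.mul_sum]
    refine Finset.sum_congr rfl fun T hT => ?_
    rw [← hf] at hT
    rw [(Finset.mem_filter.1 hT).2]
  · intro T hT
    have h1 := two_mul_card_le_of_mem_pairingsOn hT
    rw [Finset.card_univ, Fintype.card_fin] at h1
    have h2 : T.card ≠ 0 := by
      intro h
      rw [Finset.card_eq_zero] at h
      have := (mem_pairingsOn.1 hT).2.2
      rw [h, Finset.biUnion_empty] at this
      have h3 := congrArg Finset.card this
      rw [Finset.card_univ, Fintype.card_fin, Finset.card_empty] at h3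
      omega
    rw [Finset.mem_Icc]
    omega

theorem permOn_univ {α : Type*} [Fintype α] [DecidableEq α] (C : Matrix α α K) :
    permOn C Finset.univ = C.permanent := by
  simp [permOn, permsOn, Matrix.permanent]

theorem Sigma_eq_sum_permanent (hm : 1 ≤ m) {B : Matrix (Fin n) (Fin n) K} (hB : B.IsSymm)
    (E : Fin m → Fin n × Fin n) :
    Sigma hB E = ∑ A : Finset (Fin m), (-1) ^ A.card * (flipMatrix B E A).permanent := by
  rw [Sigma_eq_SigmaOn_univ hm, SigmaOn_eq_altPermOn, altPermOn, Finset.powerset_univ]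
  simp only [permOn_univ]

/-- For an odd number of pairs the alternating sum of permanents vanishes. -/
theorem sum_permanent_flipMatrix_of_odd (hm : Odd m) {B : Matrix (Fin n) (Fin n) K}
    (hB : B.IsSymm) (E : Fin m → Fin n × Fin n) :
    ∑ A : Finset (Fin m), (-1) ^ A.card * (flipMatrix B E A).permanent = 0 := by
  -- Flipping the complementary pairs interchanges all row and column labels.
  have hf : ∀ A, flipMatrix B E Aᶜ = (flipMatrix B E A).transpose := by
    intro A
    ext a b
    rw [Matrix.transpose_apply, flipMatrix, flipMatrix, Matrix.submatrix_apply,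
      Matrix.submatrix_apply, hB.apply]
    congr 1 <;> simp only [flipPair, Finset.mem_compl] <;> split_ifs <;> rfl
  refine Finset.sum_involution (fun A _ => Aᶜ) ?_ ?_ ?_ ?_
  · intro A _
    have h : (-1 : K) ^ Aᶜ.card = -(-1) ^ A.card := by
      have h1 := Finset.card_compl_add_card A
      rw [Fintype.card_fin] at h1
      have h2 : (-1 : K) ^ Aᶜ.card * (-1) ^ A.card = -1 := by
        rw [← pow_add, h1, hm.neg_one_pow]
      have h3 : (-1 : K) ^ A.card * (-1) ^ A.card = 1 := by rw [← mul_pow]; simp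
      linear_combination (-1 : K) ^ A.card * h2 - (-1 : K) ^ Aᶜ.card * h3
    rw [hf, Matrix.permanent_transpose, h]
    ring
  · intro A _ _ h
    obtain ⟨a⟩ : Nonempty (Fin m) := ⟨⟨0, hm.pos⟩⟩
    have h1 := Finset.mem_compl (s := A) (a := a)
    rw [h] at h1
    tauto
  · simp
  · simp

end SigmaOn

end InvariantForm

/-! ### From oriented edges to symmetric pairs -/

namespace InvariantForm

open ExteriorAlgebra

section Flips

variable {K : Type*} [CommRing K] {n m N : ℕ}

/-- The loops and the pairs `E`, those in `A` being swapped, as edges at the positions `θ`. -/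
def flipEdge (θ : Fin n ⊕ Fin m ≃ Fin N) (E : Fin m → Fin n × Fin n) (A : Finset (Fin m))
    (p : Fin N) : Fin n × Fin n :=
  Sum.elim (fun a => (a, a)) (flipPair E A) (θ.symm p)

theorem card_flipEdge (θ : Fin n ⊕ Fin m ≃ Fin N) (E : Fin m → Fin n × Fin n)
    (A : Finset (Fin m)) (f : Fin n × Fin n → Fin n) (hf : ∀ a, f (a, a) = a) (z : Fin n) :
    Fintype.card {p // f (flipEdge θ E A p) = z} = 1 + Fintype.card {r // f (flipPair E A r) = z} := by
  rw [Fintype.card_subtype, Fintype.card_subtype, Finset.card_filter, Finset.card_filter,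
    ← Equiv.sum_comp θ, Fintype.sum_sum_type]
  simp [flipEdge, hf]

theorem edgeIncidence_apply (i j : Fin N → Fin n) (p : Fin N)
    (c : Fin (N + 1)) : edgeIncidence i j p c
      = (if (c : ℕ) = n + j p then 1 else 0) - (if (c : ℕ) = i p then 1 else 0) := by
  have := (i p).2
  simp only [edgeIncidence, Matrix.of_apply]
  split_ifs <;> first | rfl | omega

/-- The row of a reversed pair `(t, s)` is minus the row of `(s, t)` plus the rows of the loops at
`s` and `t`. The loops belong to the graph, so each reversal contributes a factor `-1`. -/
theorem det_edgeMinor_flipEdge (θ : Fin n ⊕ Fin m ≃ Fin N)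
    (E : Fin m → Fin n × Fin n) (A : Finset (Fin m)) (k : Fin (N + 1)) :
    (edgeMinor (fun p => (flipEdge θ E A p).1) (fun p => (flipEdge θ E A p).2) k).det
      = (-1) ^ A.card *
        (edgeMinor (fun p => (flipEdge θ E ∅ p).1) (fun p => (flipEdge θ E ∅ p).2) k).det := by
  rw [← Matrix.det_submatrix_equiv_self θ,
    ← Matrix.det_submatrix_equiv_self θ (edgeMinor (fun p => (flipEdge θ E ∅ p).1) _ k)]
  have h : (edgeMinor (fun p => (flipEdge θ E A p).1) (fun p => (flipEdge θ E A p).2) k).submatrix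
        θ θ
      = Matrix.fromBlocks 1 0
          (Matrix.of fun r a => if r ∈ A then
            (if (E r).1 = a then 1 else 0) + (if (E r).2 = a then 1 else 0) else 0)
          (Matrix.diagonal fun r => if r ∈ A then -1 else 1) *
        (edgeMinor (fun p => (flipEdge θ E ∅ p).1) (fun p => (flipEdge θ E ∅ p).2) k).submatrix
          θ θ := by
    ext x y
    rw [Matrix.mul_apply, Fintype.sum_sum_type]
    simp only [Matrix.submatrix_apply, edgeMinor, edgeIncidence_apply, id_eq]
    cases x with
    | inl a => simp [flipEdge, Matrix.one_apply]
    | inr r =>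
      by_cases hr : r ∈ A
      · simp [flipEdge, flipPair, hr, Matrix.diagonal_apply, add_mul, Finset.sum_add_distrib]
        ring
      · simp [flipEdge, flipPair, hr, Matrix.diagonal_apply]
  rw [h, Matrix.det_mul, Matrix.det_fromBlocks_zero₁₂, Matrix.det_one, one_mul,
    Matrix.det_diagonal, Finset.prod_ite, Finset.prod_const_one, mul_one, Finset.prod_const,
    Finset.filter_mem_eq_inter, Finset.univ_inter]

/-- The symmetrized matrix units of the edges at the positions `θ`. -/
def edgeMatrix (K : Type*) [CommRing K] (θ : Fin n ⊕ Fin m ≃ Fin N) (E : Fin m → Fin n × Fin n)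
    (p : Fin N) : Matrix (Fin n) (Fin n) K :=
  Sum.elim (fun a => Matrix.single a a 1)
    (fun r => Matrix.single (E r).2 (E r).1 1 + Matrix.single (E r).1 (E r).2 1) (θ.symm p)

theorem altTrace_edgeMatrix_eq_sum (θ : Fin n ⊕ Fin m ≃ Fin N) (E : Fin m → Fin n × Fin n)
    (B : Matrix (Fin n) (Fin n) K) :
    altTrace K n N (fun p => B * edgeMatrix K θ E p)
      = ∑ A : Finset (Fin m), altTrace K n N
          fun p => B * Matrix.single (flipEdge θ E A p).1 (flipEdge θ E A p).2 1 := by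
  set f : Fin N → Matrix (Fin n) (Fin n) K := fun p =>
    Sum.elim (fun _ => 0) (fun r => B * Matrix.single (E r).2 (E r).1 1) (θ.symm p) with hf
  set g : Fin N → Matrix (Fin n) (Fin n) K := fun p =>
    Sum.elim (fun a => B * Matrix.single a a 1)
      (fun r => B * Matrix.single (E r).1 (E r).2 1) (θ.symm p) with hg
  have h1 : (fun p => B * edgeMatrix K θ E p) = f + g := by
    funext p
    rw [Pi.add_apply, edgeMatrix, hf, hg]
    dsimp only
    cases θ.symm p <;> simp [mul_add]
  have h2 := (altTrace K n N).toMultilinearMap.map_add_univ f g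
  rw [h1]
  refine h2.trans (Eq.symm ?_)
  refine Fintype.sum_of_injective
    (fun A : Finset (Fin m) => A.map (Function.Embedding.inr.trans θ.toEmbedding))
    (Finset.map_injective _) _ _ ?_ ?_
  -- In the multilinear expansion over positions, a set containing a loop contributes zero: a loop
  -- has only one orientation.
  · intro s hs
    obtain ⟨a, ha⟩ : ∃ a, θ (Sum.inl a) ∈ s := by
      by_contra! hc
      refine hs ⟨Finset.univ.filter fun r => θ (Sum.inr r) ∈ s, ?_⟩
      ext p
      obtain ⟨x, rfl⟩ := θ.surjective p
      cases x with
      | inl a => simp [hc a]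
      | inr r => simp
    refine (altTrace K n N).map_coord_zero (θ (Sum.inl a)) ?_
    rw [Finset.piecewise_eq_of_mem _ _ _ ha]
    simp [hf]
  · intro A
    refine congrArg (altTrace K n N) ?_
    funext p
    obtain ⟨x, rfl⟩ := θ.surjective p
    cases x with
    | inl a =>
      rw [Finset.piecewise_eq_of_notMem _ _ _ (by simp)]
      simp [hg, flipEdge]
    | inr r =>
      by_cases hr : r ∈ A
      · rw [Finset.piecewise_eq_of_mem _ _ _ (by simpa using hr)]
        simp [hf, flipEdge, flipPair, hr]
      · rw [Finset.piecewise_eq_of_notMem _ _ _ (by simpa using hr)]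
        simp [hg, flipEdge, flipPair, hr]

theorem altTrace_edgeMatrix (hn : 1 ≤ n) (hN : N + 1 = n + n) (θ : Fin n ⊕ Fin m ≃ Fin N)
    (E : Fin m → Fin n × Fin n) (B : Matrix (Fin n) (Fin n) K) (k : Fin (N + 1)) :
    altTrace K n N (fun p => B * edgeMatrix K θ E p)
      = N * B.det * (∑ A : Finset (Fin m), (-1) ^ A.card * (flipMatrix B E A).permanent) *
        ((-1) ^ (n.choose 2 + k) * ((edgeMinor (fun p => (flipEdge θ E ∅ p).1)
          (fun p => (flipEdge θ E ∅ p).2) k).det : K)) := by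
  rw [altTrace_edgeMatrix_eq_sum, Finset.mul_sum, Finset.sum_mul]
  refine Finset.sum_congr rfl fun A _ => ?_
  rw [altTrace_single hn hN (fun p => (flipEdge θ E A p).1) (fun p => (flipEdge θ E A p).2)
    (fun r => (flipPair E A r).1) (fun r => (flipPair E A r).2)
    (card_flipEdge θ E A Prod.fst fun _ => rfl) (card_flipEdge θ E A Prod.snd fun _ => rfl) B k,
    det_edgeMinor_flipEdge, ← flipMatrix]
  push_cast
  ring

end Flips

/-! ### The trace for an upper-triangular type -/

section Types

variable {K : Type*} [CommRing K] {M : Type*} [AddCommGroup M] [Module K M] {n m : ℕ}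

/-- The positions of the loops and of the other pairs of a type which contains the diagonal. -/
theorem exists_positions {ν : Finset (Fin n × Fin n)} (hν : diag n ⊆ ν)
    (e : Fin (2 * n - 1) ≃ ν) (E : Fin m ≃ (ν \ diag n : Finset (Fin n × Fin n))) :
    ∃ θ : Fin n ⊕ Fin m ≃ Fin (2 * n - 1),
      (∀ a, (e (θ (Sum.inl a)) : Fin n × Fin n) = (a, a)) ∧
      ∀ r, (e (θ (Sum.inr r)) : Fin n × Fin n) = E r := by
  have hd : ∀ a : Fin n, (a, a) ∈ diag n := fun a => by simp [diag]
  have hE : ∀ r, (E r : Fin n × Fin n) ∈ ν ∧ (E r : Fin n × Fin n) ∉ diag n :=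
    fun r => Finset.mem_sdiff.1 (E r).2
  let g : Fin n ⊕ Fin m → ν := Sum.elim (fun a => ⟨(a, a), hν (hd a)⟩) fun r => ⟨E r, (hE r).1⟩
  have hg : Function.Bijective g := by
    constructor
    · rintro (a | r) (b | s) h <;> have h := congrArg Subtype.val h <;>
        simp only [g, Sum.elim_inl, Sum.elim_inr, Prod.mk.injEq, and_self] at h
      · rw [h]
      · exact absurd (h ▸ hd a) (hE s).2
      · exact absurd (h ▸ hd b) (hE r).2
      · rw [E.injective (Subtype.ext h)]
    · rintro ⟨z, hz⟩
      by_cases h : z ∈ diag n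
      · obtain ⟨a, -, rfl⟩ := Finset.mem_image.1 h
        exact ⟨Sum.inl a, rfl⟩
      · refine ⟨Sum.inr (E.symm ⟨z, Finset.mem_sdiff.2 ⟨hz, h⟩⟩), Subtype.ext ?_⟩
        simp [g]
  refine ⟨(Equiv.ofBijective g hg).trans e.symm, fun a => ?_, fun r => ?_⟩ <;> simp [g]

theorem incidenceMinor_eq {ν : Finset (Fin n × Fin n)} (e : Fin (2 * n - 1) ≃ ν) (k : Fin (2 * n))
    (h : 2 * n = 2 * n - 1 + 1) :
    incidenceMinor e k = edgeMinor (fun p => (e p).1.1) (fun p => (e p).1.2) (Fin.cast h k) := by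
  ext a b
  have hb : ((Fin.cast h k).succAbove b : ℕ) = if (b : ℕ) < k then (b : ℕ) else b + 1 := by
    simp only [Fin.succAbove, Fin.lt_def, Fin.val_castSucc, Fin.val_cast]
    split_ifs <;> simp
  simp only [incidenceMinor, incidence, edgeMinor, edgeIncidence, Matrix.submatrix_apply,
    Matrix.of_apply, id_eq, hb]

theorem upsilon_apply_eq_sum (υ : Matrix (Fin n) (Fin n) M) (hυ : υ.IsSymm)
    {ν : Finset (Fin n × Fin n)} (hν : ∀ p ∈ ν, p.1 ≤ p.2) {N : ℕ} (e : Fin N ≃ ν) (a b : Fin n) :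
    upsilon K υ ν a b = ∑ p, (if (e p : Fin n × Fin n) = (a, b) ∨ (e p : Fin n × Fin n) = (b, a)
      then 1 else 0 : K) • ι K (υ (e p).1.1 (e p).1.2) := by
  rw [upsilon, Matrix.of_apply]
  have hval : ∀ z : Fin n × Fin n, z = (a, b) ∨ z = (b, a) → υ z.1 z.2 = υ a b := by
    rintro z (rfl | rfl)
    · rfl
    · exact hυ.apply _ _
  split_ifs with h
  · obtain ⟨z, hz, hzν⟩ : ∃ z, (z = (a, b) ∨ z = (b, a)) ∧ z ∈ ν := by
      rcases h with h | h
      · exact ⟨_, Or.inl rfl, h⟩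
      · exact ⟨_, Or.inr rfl, h⟩
    rw [Finset.sum_eq_single (e.symm ⟨z, hzν⟩)]
    · rw [Equiv.apply_symm_apply, if_pos hz, one_smul, hval z hz]
    · intro p _ hp
      rw [if_neg, zero_smul]
      intro hp'
      refine hp ((Equiv.eq_symm_apply e).2 (Subtype.ext ?_))
      -- Upper-triangularity prevents two different positions from carrying `(a, b)` and `(b, a)`.
      have h1 := hν _ (e p).2
      have h2 := hν _ hzν
      rcases hp' with hp' | hp' <;> rcases hz with rfl | rfl <;> rw [hp'] at h1 ⊢
      · exact Prod.ext (le_antisymm h1 h2) (le_antisymm h2 h1)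
      · exact Prod.ext (le_antisymm h1 h2) (le_antisymm h2 h1)
    · simp
  · refine (Finset.sum_eq_zero fun p _ => ?_).symm
    rw [if_neg, zero_smul]
    rintro (hp | hp)
    · exact h (Or.inl (hp ▸ (e p).2))
    · exact h (Or.inr (hp ▸ (e p).2))

/-- No parity of `n` enters here; the two cases differ only in the value of the alternating sum of
permanents. -/
theorem tracePow_eq (hn : 1 ≤ n) (B : Matrix (Fin n) (Fin n) K) (υ : Matrix (Fin n) (Fin n) M)
    (hυ : υ.IsSymm) {ν : Finset (Fin n × Fin n)} (hν : IsUpperTriangular ν)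
    (e : Fin (2 * n - 1) ≃ ν) (k : Fin (2 * n))
    (E : Fin m ≃ (ν \ diag n : Finset (Fin n × Fin n))) :
    tracePow B υ ν = ((2 * (n : K) - 1) * B.det * ∑ A : Finset (Fin m), (-1) ^ A.card *
      (flipMatrix B (fun r => (E r : Fin n × Fin n)) A).permanent) • omega K υ e k := by
  obtain ⟨θ, hθ1, hθ2⟩ := exists_positions hν.2.1 e E
  have hN : 2 * n - 1 + 1 = n + n := by omega
  have hedge : ∀ p, flipEdge θ (fun r => (E r : Fin n × Fin n)) ∅ p = e p := by
    intro p
    obtain ⟨x, rfl⟩ := θ.surjective p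
    cases x <;> simp [flipEdge, flipPair, hθ1, hθ2]
  have hS : ∀ p a b, edgeMatrix K θ (fun r => (E r : Fin n × Fin n)) p a b
      = if (e p : Fin n × Fin n) = (a, b) ∨ (e p : Fin n × Fin n) = (b, a) then 1 else 0 := by
    intro p a b
    obtain ⟨x, rfl⟩ := θ.surjective p
    cases x with
    | inl c =>
      rw [hθ1]
      simp only [edgeMatrix, Equiv.symm_apply_apply, Sum.elim_inl, Matrix.single_apply,
        Prod.mk.injEq]
      congr 1
      simp only [eq_iff_iff]
      tauto
    | inr r =>
      -- Off the diagonal the two matrix units occupy different places, so their sum has entries `0`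
      -- and `1` only.
      have hne : (E r).1.1 ≠ (E r).1.2 := by
        intro h
        refine (Finset.mem_sdiff.1 (E r).2).2 (Finset.mem_image.2 ⟨(E r).1.1, Finset.mem_univ _, ?_⟩)
        exact Prod.ext rfl h
      rw [hθ2]
      simp only [edgeMatrix, Equiv.symm_apply_apply, Sum.elim_inr, Matrix.add_apply,
        Matrix.single_apply, Prod.ext_iff]
      generalize (E r).1.1 = c at *
      generalize (E r).1.2 = d at *
      by_cases h1 : c = a <;> by_cases h2 : d = b <;> by_cases h3 : c = b <;> by_cases h4 : d = a <;>
        simp_all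
  have hX : ∀ a b, (B.map (algebraMap K (ExteriorAlgebra K M)) * upsilon K υ ν) a b
      = ∑ p, (B * edgeMatrix K θ (fun r => (E r : Fin n × Fin n)) p) a b •
        ι K (υ (e p).1.1 (e p).1.2) := by
    intro a b
    simp only [Matrix.mul_apply, Matrix.map_apply, upsilon_apply_eq_sum υ hυ hν.2.2 e, ← hS,
      ← Algebra.smul_def, Finset.sum_smul, Finset.smul_sum, smul_smul]
    exact Finset.sum_comm
  rw [tracePow, trace_pow_of_oneForms _ (fun p => υ (e p).1.1 (e p).1.2) _ hX,
    altTrace_edgeMatrix hn hN θ _ B (Fin.cast (by omega) k)]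
  simp only [hedge]
  rw [← incidenceMinor_eq, omega, eta, ← Int.cast_smul_eq_zsmul K, smul_smul, ιMulti_apply]
  congr 1
  rw [Nat.cast_sub (by omega)]
  push_cast
  rfl

end Types

end InvariantForm

theorem mainTheorem11 {K : Type*} [CommRing K] {M : Type*} [AddCommGroup M] [Module K M]
    (n : ℕ) (hn : 2 ≤ n)
    (B : Matrix (Fin n) (Fin n) K) (hB : B.IsSymm)
    (υ : Matrix (Fin n) (Fin n) M) (hυ : υ.IsSymm)
    (ν : Finset (Fin n × Fin n)) (hν : InvariantForm.IsUpperTriangular ν) :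
    (Odd n →
      ∀ (e : Fin (2 * n - 1) ≃ ν) (k : Fin (2 * n))
        (E : Fin (n - 1) ≃ (ν \ InvariantForm.diag n : Finset (Fin n × Fin n))),
        InvariantForm.tracePow B υ ν =
          ((2 * (n : K) - 1) * B.det * InvariantForm.Sigma hB (fun a => (E a : Fin n × Fin n))) •
            InvariantForm.omega K υ e k) ∧
    (Even n → InvariantForm.tracePow B υ ν = 0) := by
  refine ⟨fun _ e k E => ?_, fun hev => ?_⟩
  · rw [InvariantForm.Sigma_eq_sum_permanent (by omega)]
    exact InvariantForm.tracePow_eq (by omega) B υ hυ hν e k E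
  · have hd : (InvariantForm.diag n).card = n := by
      rw [InvariantForm.diag, Finset.card_image_of_injective _ fun a b h => congrArg Prod.fst h,
        Finset.card_univ, Fintype.card_fin]
    have hc : (ν \ InvariantForm.diag n).card = n - 1 := by
      rw [Finset.card_sdiff_of_subset hν.2.1, hd, show ν.card = 2 * n - 1 from hν.1]
      omega
    have hodd : Odd (n - 1) := Nat.Even.sub_odd (by omega) hev odd_one
    rw [InvariantForm.tracePow_eq (by omega) B υ hυ hν (Finset.equivFinOfCardEq hν.1).symm
      ⟨0, by omega⟩ (Finset.equivFinOfCardEq hc).symm,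
      InvariantForm.sum_permanent_flipMatrix_of_odd hodd hB, mul_zero, zero_smul]
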